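/- Let $E$ be an elliptic curve over $\mathbb{Q}$ given by a Weierstrass equation $y^2+a_1xy+a_3y=x^3+a_2x^2+a_4x+a_6$ with the usual quantities $b_2,c_4,c_6$. Let $N\ge 1$ and let $f$ be a cusp form of weight $2$ on $\Gamma_0(N)$ whose Fourier coefficients $a_n$ ($n\ge 1$) are the coefficients of the $L$-series of $E$ (for $N$ the conductor of $E$, this is the normalized newform attached to $E$). For $\tau$ in the upper half-plane $\mathcal{H}$ put $\gamma(\tau)=\int_{i\infty}^{\tau}2\pi i f(z)\,dz$, and assume that $E$ is optimal with Manin constant $1$: the set $\Lambda=\{\gamma(M\tau)-\gamma(\tau): M\in\Gamma_0(N),\ \tau\in\mathcal{H}\}$ is a lattice in $\mathbb{C}$ and is the period lattice of the given equation of $E$, i.e. $g_2(\Lambda)=c_4/12$ and $g_3(\Lambda)=c_6/216$. Let $\wp$ be the Weierstrass function of $\Lambda$ and $$x(\tau)=\wp(\gamma(\tau))-\frac{b_2}{12},\qquad y(\tau)=\frac{\wp'(\gamma(\tau))}{2}-\frac{a_1\wp(\gamma(\tau))}{2}+\frac{a_1b_2-12a_3}{24},$$ so that $\tau\mapsto (x(\tau),y(\tau))$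 induces the modular parametrization $\varphi:X_0(N)\to E$ (points with $\gamma(\tau)\in\Lambda$ going to the point at infinity), and let $d=\deg\varphi$, the number of points of $X_0(N)$ in all but finitely many fibres of $\varphi$. Let $j$ be the modular $j$-invariant. Then there is a polynomial $F_N(x,j)=\sum_{k,l}c_{k,l}x^kj^l$ with integer coefficients which is a minimal polynomial of the function $x$ over $\mathbb{C}(j)$ and is primitive, that is: $F_N\neq 0$; $F_N(x(\tau),j(\tau))=0$ for all $\tau\in\mathcal{H}$ with $\gamma(\tau)\notin\Lambda$; no nonzero polynomial relation between the functions $x$ and $j$ over $\mathbb{C}$ has smaller degree in $x$; and the coefficients $\sum_l c_{k,l}j^l\in\mathbb{Z}[j]$ have no common factor in $\mathbb{Z}[j]$ other than $\pm1$. For every such $F_N$, its degree $K$ in $x$ and its degree $L$ in $j$ satisfy $$K\le \mu=[SL_2(\mathbb{Z}):\Gamma_0(N)]\qquad\text{and}\qquad L\le 2d .$$ -/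

import Mathlib

open UpperHalfPlane MatrixGroups CongruenceSubgroup Polynomial

noncomputable section

namespace ModularParam

/-- The modular `j`-invariant on the upper half-plane, `j = E₄³ / Δ = q⁻¹ + 744 + ⋯`. -/
def kleinJ (τ : ℍ) : ℂ :=
  ModularForm.E₄ τ ^ 3 / ModularForm.discriminant τ

/-- The integral `γ(τ) = ∫_{i∞}^{τ} 2πi f(z) dz`, taken along the vertical half-line
`z = Re τ + i t` (so `dz = i dt`), with `t` running from `∞` down to `Im τ`. -/
def eichlerIntegral (f : ℍ → ℂ) (τ : ℍ) : ℂ :=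
  -∫ t in Set.Ioi τ.im,
    2 * (Real.pi : ℂ) * Complex.I * f (ofComplex ((τ.re : ℂ) + t * Complex.I)) * Complex.I

/-- `f` is the weight two cusp form on `Γ₀(N)` attached to the elliptic curve `W` over `ℚ`, and
`W` is optimal with Manin constant one: the periods of `2πi f(z) dz` over `Γ₀(N)` form the lattice
`Λ`, and `Λ` is the period lattice of the curve `W`, that is, `z ↦ (℘(z) - b₂/12, …)`
uniformizes the given Weierstrass equation (`g₂ = c₄/12`, `g₃ = c₆/216`). -/
structure IsOptimalParametrization (W : WeierstrassCurve ℚ) (N : ℕ)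
    (f : CuspForm (Gamma0 N : Subgroup (GL (Fin 2) ℝ)) 2) (Λ : PeriodPair) : Prop where
  /-- The Fourier coefficients of `f` are the coefficients of the `L`-series of `W`. -/
  coeff_eq : ∀ n : ℕ, (qExpansion 1 f).coeff n = (W.LFunction n : ℂ)
  /-- The lattice `Λ` is the set of all `γ(Mτ) - γ(τ)`, `M ∈ Γ₀(N)`. -/
  periods_eq : (Λ.lattice : Set ℂ) =
    {w | ∃ M ∈ Gamma0 N, ∃ τ : ℍ, w = eichlerIntegral f (M • τ) - eichlerIntegral f τ}
  g₂_eq : Λ.g₂ = (W.c₄ : ℂ) / 12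
  g₃_eq : Λ.g₃ = (W.c₆ : ℂ) / 216

section

variable (W : WeierstrassCurve ℚ) (f : ℍ → ℂ) (Λ : PeriodPair)

/-- The point `τ` is sent by the parametrization to the point at infinity of the curve;
equivalently `x` has a pole at `τ`. -/
def IsPole (τ : ℍ) : Prop := eichlerIntegral f τ ∈ Λ.lattice

/-- The modular function `x(τ) = ℘(γ(τ)) - b₂/12` (meaningful where `τ` is not a pole). -/
def xFun (τ : ℍ) : ℂ :=
  Λ.weierstrassP (eichlerIntegral f τ) - (W.b₂ : ℂ) / 12

/-- The modular function `y(τ) = ℘'(γ(τ))/2 - a₁ ℘(γ(τ))/2 + (a₁ b₂ - 12 a₃)/24`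
(meaningful where `τ` is not a pole). -/
def yFun (τ : ℍ) : ℂ :=
  Λ.derivWeierstrassP (eichlerIntegral f τ) / 2
    - (W.a₁ : ℂ) * Λ.weierstrassP (eichlerIntegral f τ) / 2
    + ((W.a₁ : ℂ) * W.b₂ - 12 * W.a₃) / 24

/-- The fibre of `φ = (x, y)` over the affine point `(α, β)`, inside `Y₀(N) = Γ₀(N) \ ℍ`. -/
def fibre (N : ℕ) (α β : ℂ) : Set (MulAction.orbitRel.Quotient (Gamma0 N) ℍ) :=
  {P | ∃ τ : ℍ, (Quotient.mk _ τ : MulAction.orbitRel.Quotient (Gamma0 N) ℍ) = P ∧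
    ¬ IsPole f Λ τ ∧ xFun W f Λ τ = α ∧ yFun W f Λ τ = β}

/-- `d` is the degree of `φ : X₀(N) → E`: all but finitely many points of the complex curve `E`
have exactly `d` preimages. The finitely many cusps of `X₀(N)` and the point at infinity of `E`
do not matter for this, so only points of `Y₀(N)` and affine points of `E` are considered. -/
def HasDegree (N : ℕ) (d : ℕ) : Prop :=
  {P : ℂ × ℂ | (W.baseChange ℂ).toAffine.Equation P.1 P.2 ∧
    (fibre W f Λ N P.1 P.2).encard ≠ (d : ℕ∞)}.Finite

/-- The relation `G(x, j) = 0` of modular functions. The outer variable of `G ∈ ℂ[Y][X]` stands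
for `x` and the inner one for `j`. -/
def IsRelation (G : ℂ[X][X]) : Prop :=
  ∀ τ : ℍ, ¬ IsPole f Λ τ → G.evalEval (kleinJ τ) (xFun W f Λ τ) = 0

/-- `F(x, j) = ∑ c_{k,l} x^k j^l` with integer coefficients is (up to sign) the minimal polynomial
of `x` over `ℂ(j)`: it is a nonzero relation, no nonzero relation over `ℂ[j]` has smaller degree
in `x`, and its coefficients `A_k(j) = ∑_l c_{k,l} j^l` have no common factor in `ℤ[j]`. -/
structure IsModularPolynomial (F : ℤ[X][X]) : Prop where
  ne_zero : F ≠ 0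
  relation : IsRelation W f Λ (F.map (mapRingHom (Int.castRingHom ℂ)))
  minimal : ∀ G : ℂ[X][X], G ≠ 0 → IsRelation W f Λ G → F.natDegree ≤ G.natDegree
  primitive : F.IsPrimitive

end

/-- The degree of `F(x, j)` in `x`. -/
def xDegree (F : ℤ[X][X]) : ℕ := F.natDegree

/-- The degree of `F(x, j)` in `j`. -/
def jDegree (F : ℤ[X][X]) : ℕ := F.support.sup fun k => (F.coeff k).natDegree

end ModularParam

end

noncomputable section

namespace ModularParam

open Filter Topology Set
open scoped Manifold ModularForm

local notation "𝕢" => Function.Periodic.qParam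

local notation "Δ" => ModularForm.discriminant

/-! ### The Eichler integral as an analytic function of `q` -/

section Primitive

/-! Bound in `x`. The function `x` is invariant under `Γ₀(N)`, so the product of the factors `X - x
∘ M⁻¹` over the cosets `M Γ₀(N)` in `SL(2, ℤ)` has `SL(2, ℤ)`-invariant coefficients. Each translate
`γ(Mτ)` is analytic in `exp (2πiτ/N)` on the whole unit disc, centre included, so the translates of
`x` are meromorphic on `ℍ` and at `i∞`. Hence the coefficients are rational functions of `j`, and
clearing denominators gives a nonzero relation `P` of degree at most `μ` in `x`
(`exists_relation_natDegree_le_index`).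

Integrality. The functions `x` and `j` are quotients of power series in `q` with rational
coefficients: `γ = ∑ aₙ qⁿ / n`, and the differential equation of `℘`, with `g₂` and `g₃` rational,
makes the Taylor coefficients of `z² ℘(z)` rational. A relation over `ℂ` is therefore a solution of
a linear system over `ℚ`, and applying a `ℚ`-linear form `ℂ → ℚ` to its coefficients gives another
solution (`exists_isRelation_map_rat`). Clearing denominators and dividing by the content yields
`F`.

Bound in `j`. A primitive `F` of minimal degree is irreducible over `ℂ` and divides every relation,
in particular `P`. For general `α` the polynomial `F(α, Y)` has exactly `L` distinct roots `β`. Each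
is a value `j(τ)`, and since `P(α, β) = 0`, some translate of `τ` has `x = α` with the same `j`.
This gives `L` distinct points of `Y₀(N)` above the at most two points of `E` with first coordinate
`α`, so `L ≤ 2d`. The argument counts points only and uses neither function fields nor the
compactification of `Y₀(N)`. -/

lemma hasDerivAt_qParam (h : ℝ) (z : ℂ) :
    HasDerivAt (𝕢 h) (2 * Real.pi * Complex.I / h * 𝕢 h z) z := by
  unfold Function.Periodic.qParam
  have := ((hasDerivAt_id z).const_mul (2 * (Real.pi : ℂ) * Complex.I)).div_const (h : ℂ)
  simpa [mul_comm] using this.cexp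

/-- A cusp form has a primitive which is an analytic function of the local parameter at `∞`. -/
lemma exists_primitive_cuspForm {Γ : Subgroup (GL (Fin 2) ℝ)} {k : ℤ} (f : CuspForm Γ k) {h : ℝ}
    (hh : 0 < h) (hΓ : h ∈ Γ.strictPeriods) :
    ∃ G : ℂ → ℂ, G 0 = 0 ∧
      (∀ q ∈ Metric.ball (0 : ℂ) 1, HasDerivAt G (dslope (cuspFunction h f) 0 q) q) ∧
      ∀ τ : ℍ, HasDerivAt (fun z ↦ G (𝕢 h z)) (2 * Real.pi * Complex.I / h * f τ) τ := by
  have hd : DifferentiableOn ℂ (cuspFunction h f) (Metric.ball 0 1) := fun q hq ↦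
    (ModularFormClass.differentiableAt_cuspFunction f hh hΓ
      (by simpa using hq)).differentiableWithinAt
  have hd' : DifferentiableOn ℂ (dslope (cuspFunction h f) 0) (Metric.ball 0 1) :=
    (Complex.differentiableOn_dslope (Metric.ball_mem_nhds 0 one_pos)).2 hd
  -- Up to a constant, `f dz` is `F(q)/q dq` with `F` the cusp function. As `F 0 = 0`, the quotient
  -- is the slope of `F` at `0`, which is holomorphic on the disc and so has a primitive `G`.
  obtain ⟨G, hG0, hG⟩ := hd'.isExactOn_ball.with_val_at 0 0
  refine ⟨G, hG0, hG, fun τ ↦ ?_⟩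
  have hq : 𝕢 h τ ∈ Metric.ball (0 : ℂ) 1 := by
    simpa using Function.Periodic.norm_qParam_lt_one hh τ.im_pos
  refine ((hG _ hq).comp (τ : ℂ) (hasDerivAt_qParam h τ)).congr_deriv ?_
  have h1 := sub_smul_dslope (cuspFunction h f) 0 (𝕢 h τ)
  rw [CuspFormClass.cuspFunction_apply_zero f hh hΓ,
    SlashInvariantFormClass.eq_cuspFunction f τ hΓ hh.ne'] at h1
  simp only [sub_zero, smul_eq_mul] at h1
  rw [← h1]; ring

lemma one_mem_strictPeriods_Gamma0 (N : ℕ) :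
    (1 : ℝ) ∈ (Gamma0 N : Subgroup (GL (Fin 2) ℝ)).strictPeriods := by
  simp

lemma coe_mk_im {x t : ℝ} (ht : 0 < t) : 0 < ((x : ℂ) + t * Complex.I).im := by
  simpa using ht

/-- The Eichler integral is given by the primitive vanishing at the cusp. -/
lemma exists_eichlerIntegral_eq {N : ℕ} (f : CuspForm (Gamma0 N : Subgroup (GL (Fin 2) ℝ)) 2) :
    ∃ G : ℂ → ℂ, G 0 = 0 ∧
      (∀ q ∈ Metric.ball (0 : ℂ) 1, HasDerivAt G (dslope (cuspFunction 1 f) 0 q) q) ∧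
      (∀ τ : ℍ, eichlerIntegral f τ = G (𝕢 1 τ)) ∧
      ∀ τ : ℍ, HasDerivAt (fun z ↦ eichlerIntegral f (ofComplex z))
        (2 * Real.pi * Complex.I * f τ) τ := by
  have hΓ := one_mem_strictPeriods_Gamma0 N
  obtain ⟨G, hG0, hG, hGτ⟩ := exists_primitive_cuspForm f one_pos hΓ
  have key : ∀ τ : ℍ, eichlerIntegral f τ = G (𝕢 1 τ) := by
    intro τ
    set φ : ℝ → ℂ := fun t ↦ (τ.re : ℂ) + t * Complex.I with hφ
    set F' : ℝ → ℂ := fun t ↦ 2 * (Real.pi : ℂ) * Complex.I * f (ofComplex (φ t)) * Complex.I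
      with hF'
    have hφd : ∀ t, HasDerivAt φ Complex.I t := fun t ↦ by
      simpa [hφ] using ((hasDerivAt_id t).ofReal_comp.mul_const Complex.I).const_add (τ.re : ℂ)
    have hd : ∀ t ∈ Ici τ.im, HasDerivAt (fun t ↦ G (𝕢 1 (φ t))) (F' t) t := by
      intro t ht
      have ht0 : 0 < t := τ.im_pos.trans_le ht
      have := hGτ (ofComplex (φ t))
      rw [ofComplex_apply_of_im_pos (coe_mk_im ht0)] at this
      have := HasDerivAt.scomp t this (hφd t)
      refine this.congr_deriv ?_
      simp only [hF', smul_eq_mul, hφ, ofComplex_apply_of_im_pos (coe_mk_im (x := τ.re) ht0)]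
      push_cast
      ring
    have hqt : Tendsto (fun t : ℝ ↦ 𝕢 1 (φ t)) atTop (𝓝 0) := by
      refine ((Function.Periodic.qParam_tendsto one_pos).mono_right nhdsWithin_le_nhds).comp ?_
      simp only [tendsto_comap_iff]
      convert tendsto_id using 2
      ext t
      simp [hφ]
    have hlim : Tendsto (fun t ↦ G (𝕢 1 (φ t))) atTop (𝓝 0) := by
      have := (hG 0 (by simp)).continuousAt.tendsto.comp hqt
      rwa [hG0] at this
    have hint : MeasureTheory.IntegrableOn F' (Ioi τ.im) := by
      have hbig : F' =O[atTop] fun t ↦ Real.exp (-(2 * Real.pi) * t) := by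
        have h1 := CuspFormClass.exp_decay_atImInfty f one_pos hΓ
        have ht : Tendsto (fun t : ℝ ↦ ofComplex (φ t)) atTop atImInfty := by
          refine tendsto_comap_im_ofComplex.comp ?_
          simp only [tendsto_comap_iff]
          convert tendsto_id using 2
          ext t
          simp [hφ]
        have h2 := (h1.comp_tendsto ht).const_mul_left (2 * Real.pi * Complex.I * Complex.I)
        refine (h2.congr' ?_ ?_)
        · filter_upwards with t
          simp only [hF', Function.comp]; ring
        · filter_upwards [eventually_gt_atTop 0] with t ht0
          have : (ofComplex (φ t)).im = t := by
            rw [ofComplex_apply_of_im_pos (coe_mk_im (x := τ.re) ht0)]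
            simp [UpperHalfPlane.im]
          simp [this]
      have hcont : ContinuousOn F' (Ici τ.im) := by
        intro t ht
        have ht0 : 0 < t := τ.im_pos.trans_le ht
        have hc : ContinuousAt (f ∘ ofComplex) (φ t) :=
          (mdifferentiableAt_iff.mp ((ModularFormClass.holo f) ⟨φ t, coe_mk_im ht0⟩)).continuousAt
        have : ContinuousAt (fun t ↦ (f ∘ ofComplex) (φ t)) t := hc.comp (hφd t).continuousAt
        exact ((continuousAt_const.mul this).mul continuousAt_const).continuousWithinAt
      refine ((hcont.locallyIntegrableOn measurableSet_Ici).integrableOn_of_isBigO_atTop hbig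
        ⟨Ioi 0, Ioi_mem_atTop 0, ?_⟩).mono_set Ioi_subset_Ici_self
      exact integrableOn_exp_mul_Ioi (by simpa using Real.pi_pos) 0
    have := MeasureTheory.integral_Ioi_of_hasDerivAt_of_tendsto' hd hint hlim
    unfold eichlerIntegral
    rw [this]
    have : (τ.re : ℂ) + τ.im * Complex.I = τ := Complex.re_add_im _
    simp [hφ, this]
  refine ⟨G, hG0, hG, key, fun τ ↦ ?_⟩
  refine ((hGτ τ).congr_of_eventuallyEq ?_).congr_deriv (by simp)
  filter_upwards [isOpen_upperHalfPlaneSet.mem_nhds τ.im_pos] with z hz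
  rw [key, ofComplex_apply_of_im_pos hz]

end Primitive

/-! ### Behaviour of the Eichler integral at every cusp -/

section Cusps

lemma det_coe_SL (M : SL(2, ℤ)) : (M : GL (Fin 2) ℝ).val.det = 1 := by
  rw [← Matrix.GeneralLinearGroup.val_det_apply]; simp

-- `Γ(N)` is normal in `SL(2, ℤ)` and contained in `Γ₀(N)`, so every conjugate of `Γ₀(N)` contains
-- translation by `N`. One local parameter thus serves all cusps.
open ConjAct Pointwise in
lemma natCast_mem_strictPeriods_conj (N : ℕ) (M : SL(2, ℤ)) :
    (N : ℝ) ∈ (toConjAct (M : GL (Fin 2) ℝ)⁻¹ •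
      (Gamma0 N : Subgroup (GL (Fin 2) ℝ))).strictPeriods := by
  rw [Subgroup.mem_strictPeriods_iff, map_inv, Subgroup.mem_inv_pointwise_smul_iff,
    toConjAct_smul]
  have h : (Matrix.GeneralLinearGroup.upperRightHom (N : ℝ)) ∈
      (Gamma N : Subgroup (GL (Fin 2) ℝ)) := by
    rw [← Subgroup.mem_strictPeriods_iff]; simp
  obtain ⟨T, hT, hT'⟩ := h
  rw [← hT']
  refine ⟨M * T * M⁻¹, ?_, by rw [map_mul, map_mul, map_inv]; rfl⟩
  apply Gamma1_in_Gamma0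
  have : M * T * M⁻¹ ∈ Gamma N := (Gamma_normal N).conj_mem T hT M
  rw [Gamma_mem] at this
  rw [Gamma1_mem]
  tauto

/-- Every translate of the Eichler integral is an analytic function of the local parameter. -/
lemma exists_eichlerIntegral_smul_eq {N : ℕ} [NeZero N]
    (f : CuspForm (Gamma0 N : Subgroup (GL (Fin 2) ℝ)) 2) (M : SL(2, ℤ)) :
    ∃ G : ℂ → ℂ, AnalyticOnNhd ℂ G (Metric.ball 0 1) ∧
      ∀ τ : ℍ, eichlerIntegral f (M • τ) = G (𝕢 N τ) := by
  have hN : (0 : ℝ) < N := by exact_mod_cast NeZero.pos N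
  obtain ⟨G, -, hG, hGτ⟩ := exists_primitive_cuspForm (CuspForm.translate f M) hN
    (natCast_mem_strictPeriods_conj N M)
  obtain ⟨-, -, -, -, hγ⟩ := exists_eichlerIntegral_eq f
  have hGa : AnalyticOnNhd ℂ G (Metric.ball 0 1) :=
    DifferentiableOn.analyticOnNhd
      (fun q hq ↦ (hG q hq).differentiableAt.differentiableWithinAt) Metric.isOpen_ball
  -- `f ∣ M` times `dz` is the pullback of `f dz` under `M`, so both terms have the same derivative;
  -- the factor `N` compensates the `1/N` in the derivative of the parameter.
  set D : ℂ → ℂ := fun z ↦ eichlerIntegral f (M • ofComplex z) - N * G (𝕢 N z) with hD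
  have hder : ∀ z ∈ upperHalfPlaneSet, HasDerivAt D 0 z := by
    intro z hz
    lift z to ℍ using hz
    have h1 := (hasStrictDerivAt_smul (g := (M : GL (Fin 2) ℝ))
      (by rw [det_coe_SL]; exact one_pos) z).hasDerivAt
    have h2 := hγ (M • z)
    have h3 : HasDerivAt (fun w : ℂ ↦ eichlerIntegral f (M • ofComplex w))
        (2 * Real.pi * Complex.I * f (M • z) * (1 / denom (M : GL (Fin 2) ℝ) z ^ 2)) z := by
      have h2' : HasDerivAt (fun w ↦ eichlerIntegral f (ofComplex w))
        (2 * Real.pi * Complex.I * f (M • z))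
          ((fun w ↦ ↑((M : GL (Fin 2) ℝ) • ofComplex w) : ℂ → ℂ) z) := by
        simpa using h2
      have := h2'.comp (z : ℂ) h1
      refine (this.congr_of_eventuallyEq ?_).congr_deriv (by rw [det_coe_SL]; simp)
      filter_upwards with w
      simp
    have h4 := (hGτ z).const_mul (N : ℂ)
    refine (h3.sub h4).congr_deriv ?_
    have hs : (CuspForm.translate f (M : GL (Fin 2) ℝ)) z =
        f (M • z) * denom (M : GL (Fin 2) ℝ) z ^ (-2 : ℤ) := by
      rw [CuspForm.coe_translate, ModularForm.SL_slash_apply]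
    rw [hs]
    have hN' : (N : ℂ) ≠ 0 := by exact_mod_cast hN.ne'
    have := denom_ne_zero (M : GL (Fin 2) ℝ) z
    push_cast
    field_simp
    ring
  have hconst : ∀ z ∈ upperHalfPlaneSet, D z = D Complex.I := by
    intro z hz
    refine (convex_halfSpace_im_gt 0).is_const_of_fderivWithin_eq_zero (𝕜 := ℂ)
      (f := D) ?_ ?_ hz (by simp : Complex.I ∈ {z : ℂ | 0 < z.im})
    · intro w hw; exact (hder w hw).differentiableAt.differentiableWithinAt
    · intro w hw
      have h := (hder w hw).hasFDerivAt.hasFDerivWithinAt (s := {z : ℂ | 0 < z.im})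
      rw [h.fderivWithin ((isOpen_upperHalfPlaneSet).uniqueDiffWithinAt hw)]
      ext; simp
  refine ⟨fun q ↦ N * G q + D Complex.I,
    (analyticOnNhd_const.mul hGa).add analyticOnNhd_const, fun τ ↦ ?_⟩
  have := hconst τ τ.im_pos
  rw [← this]
  simp only [hD, ofComplex_apply]
  ring

end Cusps

/-! ### Level one: holomorphic modular functions are polynomials in `j` -/

section LevelOne

lemma modularForm_smul {k : ℤ} {F : Type*} [FunLike F ℍ ℂ] [SlashInvariantFormClass F 𝒮ℒ k]
    (f : F) (A : SL(2, ℤ)) (τ : ℍ) : f (A • τ) = denom A τ ^ k * f τ := by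
  have := SlashInvariantForm.slash_action_eqn'' f (γ := (A : GL (Fin 2) ℝ))
    (show _ ∈ MonoidHom.range _ from ⟨A, rfl⟩) τ
  simpa using this

lemma discriminant_smul (A : SL(2, ℤ)) (τ : ℍ) : Δ (A • τ) = denom A τ ^ 12 * Δ τ := by
  have := modularForm_smul CuspForm.discriminant A τ
  simpa using this

lemma kleinJ_smul (A : SL(2, ℤ)) (τ : ℍ) : kleinJ (A • τ) = kleinJ τ := by
  have h1 := modularForm_smul ModularForm.E₄ A τ
  have h := denom_ne_zero (A : GL (Fin 2) ℝ) τ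
  have hΔ := ModularForm.discriminant_ne_zero τ
  unfold kleinJ
  rw [h1, discriminant_smul]
  field_simp

lemma analyticAt_comp_ofComplex {f : ℍ → ℂ} (hf : MDiff f) (τ : ℍ) :
    AnalyticAt ℂ (fun z ↦ f (ofComplex z)) τ :=
  (UpperHalfPlane.mdifferentiable_iff.mp hf).analyticAt (isOpen_upperHalfPlaneSet.mem_nhds τ.im_pos)

lemma mdiff_of_analyticAt {f : ℍ → ℂ}
    (hf : ∀ τ : ℍ, AnalyticAt ℂ (fun z ↦ f (ofComplex z)) τ) : MDiff f :=
  fun τ ↦ mdifferentiableAt_iff.mpr (hf τ).differentiableAt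

lemma mdiff_discriminant : MDiff (Δ : ℍ → ℂ) := CuspForm.discriminant.holo'

lemma mdiff_kleinJ : MDiff kleinJ :=
  mdiff_of_analyticAt fun τ ↦
    ((analyticAt_comp_ofComplex ModularForm.E₄.holo' τ).pow 3).div
      (analyticAt_comp_ofComplex mdiff_discriminant τ) (ModularForm.discriminant_ne_zero _)

lemma E₄_tendsto : Tendsto ModularForm.E₄ atImInfty (𝓝 1) := by
  have h := one_mem_strictPeriods_SL
  have ha := ModularFormClass.analyticAt_cuspFunction_zero ModularForm.E₄ one_pos h
  have := ha.continuousAt.tendsto.comp (qParam_tendsto_atImInfty one_pos)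
  have h0 : cuspFunction 1 ModularForm.E₄ 0 = 1 := by
    have := EisensteinSeries.E_qExpansion_coeff_zero (k := 4) (by norm_num) ⟨2, rfl⟩
    simpa [qExpansion_coeff] using this
  rw [h0] at this
  exact this.congr (fun τ ↦ SlashInvariantFormClass.eq_cuspFunction _ τ h one_ne_zero)

/-- A modular form of level one and weight `12 m` is `Δ ^ m` times a polynomial in `j`. -/
lemma exists_eq_discriminant_pow_mul_eval (m : ℕ) (g : ModularForm 𝒮ℒ ((12 * m : ℕ) : ℤ)) :
    ∃ Q : ℂ[X], ∀ τ, g τ = Δ τ ^ m * Q.eval (kleinJ τ) := by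
  induction m with
  | zero =>
    obtain ⟨c, hc⟩ := ModularFormClass.levelOne_weight_zero_const (F := ModularForm 𝒮ℒ 0) g
    exact ⟨C c, fun τ ↦ by simpa using congrFun hc τ⟩
  | succ m ih =>
    have hw : ((3 * (m + 1) : ℕ) : ℤ) * 4 = ((12 * (m + 1) : ℕ) : ℤ) := by push_cast; ring
    -- `E₄ ^ (3(m+1))` has the right weight and constant term `1`, and equals `(jΔ)^(m+1)`.
    -- Subtracting a multiple of it leaves a cusp form, and dividing by `Δ` lowers the weight by
    -- `12`.
    set e : ModularForm 𝒮ℒ ((12 * (m + 1) : ℕ) : ℤ) :=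
      ModularForm.mcast (by push_cast; ring) (ModularForm.E₄.pow (3 * (m + 1))) with he
    have heτ : ∀ τ, e τ = ModularForm.E₄ τ ^ (3 * (m + 1)) := fun τ ↦ by
      rw [he, ModularForm.mcast_apply, ModularForm.coe_pow]; rfl
    set c := (qExpansion 1 g).coeff 0
    have he0 : (qExpansion 1 e).coeff 0 = 1 := by
      have h := one_mem_strictPeriods_SL
      have ha := ModularFormClass.analyticAt_cuspFunction_zero e one_pos h
      rw [qExpansion_coeff_zero one_pos ha (SlashInvariantFormClass.periodic_comp_ofComplex e h)]
      refine Tendsto.limUnder_eq ?_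
      have := E₄_tendsto.pow (3 * (m + 1))
      rw [one_pow] at this
      exact this.congr fun τ ↦ (heτ τ).symm
    have h0 : (qExpansion 1
        (g - c • e : ModularForm 𝒮ℒ ((12 * (m + 1) : ℕ) : ℤ))).coeff 0 = 0 := by
      have h := one_mem_strictPeriods_SL
      rw [FunLike.coe_sub, ModularForm.qExpansion_sub one_pos h]
      rw [FunLike.coe_smul, ModularForm.qExpansion_smul one_pos h]
      simp [c, -PowerSeries.coeff_zero_eq_constantCoeff, he0]
    obtain ⟨Q, hQ⟩ := ih (ModularForm.mcast (by push_cast; ring)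
      (CuspForm.discriminantEquiv ((g - c • e).toCuspForm h0)))
    refine ⟨C c * X ^ (m + 1) + Q, fun τ ↦ ?_⟩
    have h1 := hQ τ
    rw [ModularForm.mcast_apply, CuspForm.discriminantEquiv_apply,
      ModularForm.toCuspForm_apply] at h1
    have hΔ := ModularForm.discriminant_ne_zero τ
    have h2 : g τ - c * e τ = Δ τ * (Δ τ ^ m * eval (kleinJ τ) Q) := by
      rw [← h1, mul_div_cancel₀ _ hΔ]; rfl
    rw [sub_eq_iff_eq_add] at h2
    rw [h2, heτ]
    simp only [eval_add, eval_mul, eval_C, eval_pow, eval_X]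
    have hj : ModularForm.E₄ τ ^ 3 = kleinJ τ * Δ τ := by rw [kleinJ, div_mul_cancel₀ _ hΔ]
    rw [pow_mul, hj]
    ring

lemma slash_mul_discriminant_pow {φ : ℍ → ℂ} (hinv : ∀ (A : SL(2, ℤ)) τ, φ (A • τ) = φ τ)
    (m : ℕ) (A : SL(2, ℤ)) :
    (fun τ ↦ φ τ * Δ τ ^ m) ∣[((12 * m : ℕ) : ℤ)] A = fun τ ↦ φ τ * Δ τ ^ m := by
  ext τ
  rw [ModularForm.SL_slash_apply, hinv, discriminant_smul]
  have h := denom_ne_zero (A : GL (Fin 2) ℝ) τ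
  rw [zpow_neg, zpow_natCast, mul_pow, ← pow_mul]
  field_simp

/-- The modular form `φ Δ ^ m` attached to a holomorphic `SL(2, ℤ)`-invariant function `φ`. -/
def levelOneForm (φ : ℍ → ℂ) (hinv : ∀ (A : SL(2, ℤ)) τ, φ (A • τ) = φ τ)
    (hhol : MDiff φ) (m : ℕ) (hbd : IsBoundedAtImInfty fun τ ↦ φ τ * Δ τ ^ m) :
    ModularForm 𝒮ℒ ((12 * m : ℕ) : ℤ) where
  toFun τ := φ τ * Δ τ ^ m
  slash_action_eq' := fun _ ⟨A, hA⟩ ↦ hA ▸ slash_mul_discriminant_pow hinv m A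
  holo' := mdiff_of_analyticAt fun τ ↦ AnalyticAt.fun_mul (analyticAt_comp_ofComplex hhol τ)
    (AnalyticAt.fun_pow (analyticAt_comp_ofComplex mdiff_discriminant τ) m)
  bdd_at_cusps' {c} hc := by
    rw [Subgroup.IsArithmetic.isCusp_iff_isCusp_SL2Z] at hc
    rw [OnePoint.isBoundedAt_iff_forall_SL2Z hc]
    intro A _
    rw [slash_mul_discriminant_pow hinv m A]
    exact hbd

/-- A holomorphic `SL(2, ℤ)`-invariant function with at most a pole at `∞` is a polynomial
in `j`. -/
lemma exists_eq_eval_kleinJ {φ : ℍ → ℂ} (hinv : ∀ (A : SL(2, ℤ)) τ, φ (A • τ) = φ τ)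
    (hhol : MDiff φ) (m : ℕ) (hbd : IsBoundedAtImInfty fun τ ↦ φ τ * Δ τ ^ m) :
    ∃ Q : ℂ[X], ∀ τ, φ τ = Q.eval (kleinJ τ) := by
  obtain ⟨Q, hQ⟩ := exists_eq_discriminant_pow_mul_eval m (levelOneForm φ hinv hhol m hbd)
  refine ⟨Q, fun τ ↦ ?_⟩
  have h : φ τ * Δ τ ^ m = Δ τ ^ m * Q.eval (kleinJ τ) := hQ τ
  have hΔ := pow_ne_zero m (ModularForm.discriminant_ne_zero τ)
  rw [mul_comm] at h
  exact mul_left_cancel₀ hΔ h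

/-- If `β` were omitted, `(j - β)⁻¹` would be a level one form of weight zero, hence constant, with
limit `0` at `i∞`; but it never vanishes. -/
lemma kleinJ_surjective : Function.Surjective kleinJ := by
  intro β
  by_contra! hβ
  have hne : ∀ τ, kleinJ τ - β ≠ 0 := fun τ ↦ sub_ne_zero.2 (hβ τ)
  have hlim : Tendsto (fun τ ↦ (kleinJ τ - β)⁻¹) atImInfty (𝓝 0) := by
    have h1 := (E₄_tendsto.pow 3).sub
      (ModularForm.discriminant_isZeroAtImInfty.const_mul β)
    have h2 := Tendsto.div ModularForm.discriminant_isZeroAtImInfty h1 (by simp)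
    rw [zero_div] at h2
    refine h2.congr fun τ ↦ ?_
    have hΔ := ModularForm.discriminant_ne_zero τ
    simp only [Pi.div_apply, kleinJ]
    rw [div_sub' hΔ, inv_div, mul_comm β]
  obtain ⟨c, hc⟩ := ModularFormClass.levelOne_weight_zero_const (F := ModularForm 𝒮ℒ 0)
    (levelOneForm (fun τ ↦ (kleinJ τ - β)⁻¹) (fun A τ ↦ by rw [kleinJ_smul])
      (mdiff_of_analyticAt fun τ ↦ AnalyticAt.fun_inv
        (AnalyticAt.fun_sub (analyticAt_comp_ofComplex mdiff_kleinJ τ) analyticAt_const) (hne _)) 0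
      (by simp only [pow_zero, mul_one]; exact hlim.isBigO_one ℝ))
  have hc' : ∀ τ, (kleinJ τ - β)⁻¹ = c := fun τ ↦ by
    have : (kleinJ τ - β)⁻¹ * Δ τ ^ 0 = c := congrFun hc τ
    simpa using this
  have : c = 0 := tendsto_nhds_unique tendsto_const_nhds (hlim.congr hc')
  exact inv_ne_zero (hne I) ((hc' I).trans this)

end LevelOne

/-! ### Level one: meromorphic modular functions are rational in `j` -/

section Meromorphic

/-- The ring of functions on `ℍ` which are meromorphic on `ℍ` and, near `i∞`, meromorphic in the
local parameter `q = exp (2 π i τ / h)`. -/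
def meroRing (h : ℝ) : Subring (ℍ → ℂ) where
  carrier := {φ | (∀ τ : ℍ, MeromorphicAt (fun z ↦ φ (ofComplex z)) τ) ∧
    ∃ u : ℂ → ℂ, MeromorphicAt u 0 ∧ ∀ᶠ τ in atImInfty, φ τ = u (𝕢 h τ)}
  mul_mem' := by
    rintro a b ⟨ha, u, hu, ha'⟩ ⟨hb, ξ, hξ, hb'⟩
    refine ⟨fun τ ↦ (ha τ).mul (hb τ), u * ξ, hu.mul hξ, ?_⟩
    filter_upwards [ha', hb'] with τ h1 h2
    simp [h1, h2]
  one_mem' := ⟨fun τ ↦ .const 1 _, fun _ ↦ 1, .const 1 _, by simp⟩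
  add_mem' := by
    rintro a b ⟨ha, u, hu, ha'⟩ ⟨hb, ξ, hξ, hb'⟩
    refine ⟨fun τ ↦ (ha τ).add (hb τ), u + ξ, hu.add hξ, ?_⟩
    filter_upwards [ha', hb'] with τ h1 h2
    simp [h1, h2]
  zero_mem' := ⟨fun τ ↦ .const 0 _, fun _ ↦ 0, .const 0 _, by simp⟩
  neg_mem' := by
    rintro a ⟨ha, u, hu, ha'⟩
    refine ⟨fun τ ↦ (ha τ).neg, -u, hu.neg, ?_⟩
    filter_upwards [ha'] with τ h1
    simp [h1]

lemma mem_meroRing {h : ℝ} {φ : ℍ → ℂ} : φ ∈ meroRing h ↔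
    (∀ τ : ℍ, MeromorphicAt (fun z ↦ φ (ofComplex z)) τ) ∧
      ∃ u : ℂ → ℂ, MeromorphicAt u 0 ∧ ∀ᶠ τ in atImInfty, φ τ = u (𝕢 h τ) :=
  Iff.rfl

lemma const_mem_meroRing (h : ℝ) (c : ℂ) : (fun _ ↦ c) ∈ meroRing h :=
  mem_meroRing.2 ⟨fun τ ↦ .const c _, fun _ ↦ c, .const c _, by simp⟩

lemma eval_mem_meroRing {h : ℝ} {φ : ℍ → ℂ} (hφ : φ ∈ meroRing h) (P : ℂ[X]) :
    (fun τ ↦ P.eval (φ τ)) ∈ meroRing h := by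
  have : (fun τ ↦ P.eval (φ τ)) = ∑ i ∈ Finset.range (P.natDegree + 1),
      (fun _ ↦ P.coeff i) * φ ^ i := by
    ext τ
    simp [eval_eq_sum_range]
  rw [this]
  exact Subring.sum_mem _ fun i _ ↦
    Subring.mul_mem _ (const_mem_meroRing h _) (Subring.pow_mem _ hφ i)

lemma qParam_natCast_pow (N : ℕ) [NeZero N] (z : ℂ) : 𝕢 N z ^ N = 𝕢 1 z := by
  have hN : (N : ℂ) ≠ 0 := by exact_mod_cast NeZero.ne N
  unfold Function.Periodic.qParam
  rw [← Complex.exp_nat_mul]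
  congr 1
  push_cast
  field_simp

lemma kleinJ_mem_meroRing (N : ℕ) [NeZero N] : kleinJ ∈ meroRing N := by
  have h := one_mem_strictPeriods_SL
  have h1 := ModularFormClass.analyticAt_cuspFunction_zero ModularForm.E₄ one_pos h
  have h2 := ModularFormClass.analyticAt_cuspFunction_zero CuspForm.discriminant one_pos h
  refine mem_meroRing.2 ⟨fun τ ↦ (analyticAt_comp_ofComplex mdiff_kleinJ τ).meromorphicAt,
    (fun q ↦ cuspFunction 1 ModularForm.E₄ q ^ 3 / cuspFunction 1 CuspForm.discriminant q) ∘
      fun q ↦ q ^ N, ?_, ?_⟩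
  · refine MeromorphicAt.comp_analyticAt ?_ (analyticAt_id.pow N)
    rw [zero_pow (NeZero.ne N)]
    exact (h1.meromorphicAt.pow 3).div h2.meromorphicAt
  · filter_upwards with τ
    simp only [Function.comp, qParam_natCast_pow]
    rw [SlashInvariantFormClass.eq_cuspFunction _ τ h one_ne_zero,
      SlashInvariantFormClass.eq_cuspFunction _ τ h one_ne_zero]
    rfl

/-- `Δ` decays at least as fast as the local parameter, so a power of it absorbs the pole at `i∞`.
-/
lemma exists_isBoundedAtImInfty_mul_pow {N : ℕ} [NeZero N] {φ : ℍ → ℂ} (hφ : φ ∈ meroRing N) :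
    ∃ n : ℕ, IsBoundedAtImInfty fun τ ↦ φ τ * Δ τ ^ n := by
  obtain ⟨-, u, ⟨n, hn⟩, hu⟩ := mem_meroRing.1 hφ
  have hN : (0 : ℝ) < N := by exact_mod_cast NeZero.pos N
  refine ⟨n, ?_⟩
  have h1 : (fun τ : ℍ ↦ 𝕢 N τ ^ n * u (𝕢 N τ)) =O[atImInfty] (1 : ℍ → ℝ) := by
    have := (hn.continuousAt.tendsto.comp (qParam_tendsto_atImInfty hN)).isBigO_one ℝ
    simp only [sub_zero, smul_eq_mul, Function.comp_def] at this
    exact this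
  have h2 : (Δ : ℍ → ℂ) =O[atImInfty] fun τ : ℍ ↦ 𝕢 N τ := by
    refine (CuspFormClass.exp_decay_atImInfty (h := 1) CuspForm.discriminant one_pos
      one_mem_strictPeriods_SL).trans (.of_bound 1 ?_)
    filter_upwards with τ
    rw [Function.Periodic.norm_qParam, Real.norm_of_nonneg (Real.exp_pos _).le, one_mul,
      Real.exp_le_exp, div_one]
    rw [le_div_iff₀ hN]
    have : (1 : ℝ) ≤ N := by exact_mod_cast NeZero.one_le
    have h3 : 0 < 2 * Real.pi * τ.im := by have := τ.im_pos; positivity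
    have h4 : (τ : ℂ).im = τ.im := rfl
    rw [h4]
    nlinarith
  have h3 : (fun τ ↦ φ τ * Δ τ ^ n) =O[atImInfty] fun τ : ℍ ↦ 𝕢 N τ ^ n * u (𝕢 N τ) := by
    have h5 : φ =O[atImInfty] fun τ : ℍ ↦ u (𝕢 N τ) := (EventuallyEq.isBigO hu)
    simpa [mul_comm] using h5.mul (h2.pow n)
  exact h3.trans h1

/-- Poles of a meromorphic function of the local parameter do not accumulate at `0`. This leaves
only a compact part of the fundamental domain in which to look for poles. -/
lemma exists_analyticAt_of_lt_im {N : ℕ} [NeZero N] {φ : ℍ → ℂ} (hφ : φ ∈ meroRing N) :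
    ∃ Y : ℝ, ∀ τ : ℍ, Y < τ.im → AnalyticAt ℂ (fun z ↦ φ (ofComplex z)) τ := by
  obtain ⟨-, u, hu, hhu'⟩ := mem_meroRing.1 hφ
  have hN : (0 : ℝ) < N := by exact_mod_cast NeZero.pos N
  have h1 : ∀ᶠ τ : ℍ in atImInfty, AnalyticAt ℂ u (𝕢 N τ) :=
    ((Function.Periodic.qParam_tendsto hN).comp tendsto_coe_atImInfty).eventually
      hu.eventually_analyticAt
  obtain ⟨Y, hY⟩ := (atImInfty_mem _).1 (hhu'.and h1)
  refine ⟨Y, fun τ hτ ↦ ?_⟩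
  have h2 : AnalyticAt ℂ (fun z ↦ u (𝕢 N z)) τ :=
    (hY τ hτ.le).2.comp ((Function.Periodic.differentiable_qParam (h := N)).analyticAt τ)
  refine h2.congr ?_
  have h3 : {z : ℂ | 0 < z.im ∧ Y < z.im} ∈ 𝓝 (τ : ℂ) :=
    ((isOpen_lt continuous_const Complex.continuous_im).inter
      (isOpen_lt continuous_const Complex.continuous_im)).mem_nhds ⟨τ.im_pos, hτ⟩
  filter_upwards [h3] with z hz
  have h4 := (hY ⟨z, hz.1⟩ hz.2.le).1
  rw [ofComplex_apply_of_im_pos hz.1, h4]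

/-- `j - j(τ)` is divisible by `z - τ`. Its exact order of vanishing, larger at elliptic points, is
irrelevant. -/
lemma exists_analyticAt_kleinJ_sub_pow_mul {φ : ℍ → ℂ} (τ : ℍ)
    (hφ : MeromorphicAt (fun z ↦ φ (ofComplex z)) τ) :
    ∃ n : ℕ, AnalyticAt ℂ (fun z ↦ (kleinJ (ofComplex z) - kleinJ τ) ^ n * φ (ofComplex z)) τ := by
  obtain ⟨n, hn⟩ := hφ
  refine ⟨n, ?_⟩
  have hU := isOpen_upperHalfPlaneSet.mem_nhds τ.im_pos
  have hd : AnalyticAt ℂ (dslope (fun z ↦ kleinJ (ofComplex z)) τ) τ :=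
    ((Complex.differentiableOn_dslope hU).2
      (UpperHalfPlane.mdifferentiable_iff.mp mdiff_kleinJ)).analyticAt hU
  refine ((hd.pow n).mul hn).congr (Eventually.of_forall fun z ↦ ?_)
  have := sub_smul_dslope (fun z ↦ kleinJ (ofComplex z)) (τ : ℂ) z
  simp only [ofComplex_apply] at this
  simp only [Pi.mul_apply, Pi.pow_apply, smul_eq_mul, ← this, mul_pow]
  ring

lemma analyticAt_smul (A : SL(2, ℤ)) (τ : ℍ) :
    AnalyticAt ℂ (fun z ↦ ((A • ofComplex z : ℍ) : ℂ)) τ := by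
  have h : DifferentiableOn ℂ (fun z ↦ ((A • ofComplex z : ℍ) : ℂ)) upperHalfPlaneSet := by
    intro z hz
    lift z to ℍ using hz
    exact (hasStrictDerivAt_smul (g := (A : GL (Fin 2) ℝ))
      (by rw [det_coe_SL]; exact one_pos) z).hasDerivAt.differentiableAt.differentiableWithinAt
  exact h.analyticAt (isOpen_upperHalfPlaneSet.mem_nhds τ.im_pos)

lemma analyticAt_of_smul {ψ : ℍ → ℂ} (hinv : ∀ (A : SL(2, ℤ)) τ, ψ (A • τ) = ψ τ)
    (A : SL(2, ℤ)) (τ : ℍ) (h : AnalyticAt ℂ (fun z ↦ ψ (ofComplex z)) ↑(A • τ)) :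
    AnalyticAt ℂ (fun z ↦ ψ (ofComplex z)) τ := by
  have h' : AnalyticAt ℂ (fun z ↦ ψ (ofComplex z))
      ((fun z ↦ ((A • ofComplex z : ℍ) : ℂ)) τ) := by simpa using h
  refine (AnalyticAt.comp (f := fun z ↦ ((A • ofComplex z : ℍ) : ℂ)) h' (analyticAt_smul A τ)).congr
    (Eventually.of_forall fun z ↦ ?_)
  simp only [Function.comp, ofComplex_apply, hinv]

/-- A meromorphic modular function of level one is a rational function of `j`. -/
lemma exists_eval_kleinJ_mul_eq {N : ℕ} [NeZero N] {φ : ℍ → ℂ} (hφ : φ ∈ meroRing N)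
    (hinv : ∀ (A : SL(2, ℤ)) τ, φ (A • τ) = φ τ) :
    ∃ D Q : ℂ[X], D ≠ 0 ∧ ∀ τ, D.eval (kleinJ τ) * φ τ = Q.eval (kleinJ τ) := by
  classical
  obtain ⟨Y, hY⟩ := exists_analyticAt_of_lt_im hφ
  -- Around each point, `φ` is analytic except possibly at that point, so the centres of a finite
  -- subcover contain all poles in the truncated domain.
  have hiso : ∀ τ ∈ ModularGroup.truncatedFundamentalDomain Y,
      {σ : ℍ | σ ≠ τ → AnalyticAt ℂ (fun z ↦ φ (ofComplex z)) σ} ∈ 𝓝 τ := by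
    intro τ _
    have := ((mem_meroRing.1 hφ).1 τ).eventually_analyticAt
    rw [eventually_nhdsWithin_iff] at this
    filter_upwards [UpperHalfPlane.continuous_coe.continuousAt.eventually this] with σ hσ hne
    exact hσ (by simpa using UpperHalfPlane.ext_iff.not.1 hne)
  obtain ⟨t, -, ht⟩ := (ModularGroup.isCompact_truncatedFundamentalDomain Y).elim_nhds_subcover
    _ hiso
  choose n hn using fun τ ↦ exists_analyticAt_kleinJ_sub_pow_mul τ ((mem_meroRing.1 hφ).1 τ)
  set D : ℂ[X] := ∏ τ ∈ t, (X - C (kleinJ τ)) ^ n τ with hD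
  have hD0 : D ≠ 0 := Finset.prod_ne_zero_iff.2 fun τ _ ↦ pow_ne_zero _ (X_sub_C_ne_zero _)
  set ψ : ℍ → ℂ := fun τ ↦ D.eval (kleinJ τ) * φ τ with hψ
  have hψinv : ∀ (A : SL(2, ℤ)) τ, ψ (A • τ) = ψ τ := fun A τ ↦ by
    simp only [hψ, kleinJ_smul, hinv]
  have hpoly : ∀ (P : ℂ[X]) (τ : ℍ), AnalyticAt ℂ (fun z ↦ P.eval (kleinJ (ofComplex z))) τ :=
    fun P τ ↦ by
      simpa using (analyticAt_comp_ofComplex mdiff_kleinJ τ).aeval_polynomial P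
  have hψfd : ∀ τ ∈ ModularGroup.fd, AnalyticAt ℂ (fun z ↦ ψ (ofComplex z)) τ := by
    intro τ hτ
    by_cases hτt : τ ∈ t
    · refine ((hpoly (∏ σ ∈ t.erase τ, (X - C (kleinJ σ)) ^ n σ) τ).mul (hn τ)).congr
        (Eventually.of_forall fun z ↦ ?_)
      simp only [hψ, hD, Pi.mul_apply]
      rw [← Finset.mul_prod_erase t _ hτt]
      simp only [eval_mul, eval_pow, eval_sub, eval_X, eval_C]
      ring
    · refine (hpoly D τ).mul ?_
      by_cases hτY : Y < τ.im
      · exact hY τ hτY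
      · obtain ⟨σ, hσ, hτσ⟩ := mem_iUnion₂.1 (ht ⟨hτ, not_lt.1 hτY⟩)
        exact hτσ (fun h ↦ hτt (h ▸ hσ))
  have hψhol : MDiff ψ := mdiff_of_analyticAt fun τ ↦ by
    obtain ⟨A, hA⟩ := ModularGroup.exists_smul_mem_fd τ
    exact analyticAt_of_smul hψinv A τ (hψfd _ hA)
  have hψmem : ψ ∈ meroRing N :=
    Subring.mul_mem _ (eval_mem_meroRing (kleinJ_mem_meroRing N) D) hφ
  obtain ⟨m, hm⟩ := exists_isBoundedAtImInfty_mul_pow hψmem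
  obtain ⟨Q, hQ⟩ := exists_eq_eval_kleinJ hψinv hψhol m hm
  exact ⟨D, Q, hD0, hQ⟩

end Meromorphic

/-! ### The polynomial whose roots are the translates of a modular function -/

section TranslateProduct

variable {N : ℕ} [NeZero N]

lemma coeff_prod_X_sub_C_mem {R ι : Type*} [CommRing R] (S : Subring R) (s : Finset ι)
    (a : ι → R) (ha : ∀ i ∈ s, a i ∈ S) (k : ℕ) :
    (∏ i ∈ s, (X - C (a i))).coeff k ∈ S := by
  have : ∏ i ∈ s, (X - C (a i)) ∈ Polynomial.lifts S.subtype := by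
    refine Subsemiring.prod_mem _ fun i hi ↦ ?_
    exact (Polynomial.mem_lifts _).2 ⟨X - C ⟨a i, ha i hi⟩, by simp⟩
  obtain ⟨x, hx⟩ := (lifts_iff_coeff_lifts _).1 this k
  exact hx ▸ x.2

/-- The polynomial with roots the translates of a modular function for `Γ₀(N)` has, up to a
common denominator, coefficients which are polynomials in `j`. -/
lemma exists_evalEval_kleinJ_eq_prod (φ : ℍ → ℂ)
    (hinv : ∀ A ∈ Gamma0 N, ∀ τ, φ (A • τ) = φ τ)
    (hφ : ∀ M : SL(2, ℤ), (fun τ ↦ φ (M • τ)) ∈ meroRing N) :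
    ∃ (P : ℂ[X][X]) (D : ℂ[X]), D ≠ 0 ∧ P.natDegree ≤ (Gamma0 N).index ∧ P ≠ 0 ∧
      (∀ τ, P.evalEval (kleinJ τ) (φ τ) = 0) ∧
      ∀ τ α, D.eval (kleinJ τ) ≠ 0 → P.evalEval (kleinJ τ) α = 0 →
        ∃ M : SL(2, ℤ), φ (M • τ) = α := by
  classical
  have : Fintype (SL(2, ℤ) ⧸ Gamma0 N) := Subgroup.fintypeQuotientOfFiniteIndex
  set μ := (Gamma0 N).index
  have hμ : Fintype.card (SL(2, ℤ) ⧸ Gamma0 N) = μ := by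
    rw [← Nat.card_eq_fintype_card]; rfl
  have hwd : ∀ (M : SL(2, ℤ)) τ, φ ((M : SL(2, ℤ) ⧸ Gamma0 N).out⁻¹ • τ) = φ (M⁻¹ • τ) := by
    intro M τ
    obtain ⟨A, hA⟩ := QuotientGroup.mk_out_eq_mul (Gamma0 N) M
    rw [hA, mul_inv_rev, mul_smul, hinv _ (inv_mem A.2)]
  -- Left cosets `M Γ₀(N)` index the translates by `M⁻¹`, which depend only on the coset by
  -- invariance of `φ`. Moving `τ` by `A` permutes the cosets through `A⁻¹`, so it leaves the
  -- product `R` unchanged.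
  set ψ : SL(2, ℤ) ⧸ Gamma0 N → ℍ → ℂ := fun c τ ↦ φ (c.out⁻¹ • τ) with hψ
  set R : (ℍ → ℂ)[X] := ∏ c, (X - C (ψ c)) with hR
  have hRτ : ∀ τ, R.map (Pi.evalRingHom (fun _ ↦ ℂ) τ) = ∏ c, (X - C (ψ c τ)) := fun τ ↦ by
    rw [hR, Polynomial.map_prod]; simp
  have hRA : ∀ (A : SL(2, ℤ)) τ, R.map (Pi.evalRingHom (fun _ ↦ ℂ) (A • τ)) =
      R.map (Pi.evalRingHom (fun _ ↦ ℂ) τ) := by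
    intro A τ
    rw [hRτ, hRτ]
    refine Fintype.prod_equiv (MulAction.toPerm A⁻¹) _ _ fun c ↦ ?_
    induction c using QuotientGroup.induction_on with
    | H M =>
      have h1 : ψ (M : SL(2, ℤ) ⧸ Gamma0 N) (A • τ) = φ (M⁻¹ • A • τ) := hwd _ _
      have h2 : (MulAction.toPerm A⁻¹) (M : SL(2, ℤ) ⧸ Gamma0 N) =
        ((A⁻¹ * M : SL(2, ℤ)) : SL(2, ℤ) ⧸ Gamma0 N) := rfl
      rw [h1, h2]
      have h3 : ψ ((A⁻¹ * M : SL(2, ℤ)) : SL(2, ℤ) ⧸ Gamma0 N) τ = φ ((A⁻¹ * M)⁻¹ • τ) := hwd _ _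
      rw [h3, mul_inv_rev, inv_inv, mul_smul]
  have hcoeff : ∀ k, ∃ D Q : ℂ[X], D ≠ 0 ∧
      ∀ τ, D.eval (kleinJ τ) * R.coeff k τ = Q.eval (kleinJ τ) := by
    intro k
    refine exists_eval_kleinJ_mul_eq (N := N)
      (coeff_prod_X_sub_C_mem _ _ _ (fun c _ ↦ hφ c.out⁻¹) k) fun A τ ↦ ?_
    have := congrArg (fun p ↦ p.coeff k) (hRA A τ)
    simpa using this
  choose D Q hD hQ using hcoeff
  set D₀ : ℂ[X] := ∏ k ∈ Finset.range (μ + 1), D k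
  set P : ℂ[X][X] := ∑ k ∈ Finset.range (μ + 1),
    monomial k (Q k * ∏ i ∈ (Finset.range (μ + 1)).erase k, D i) with hP
  have hD₀ : D₀ ≠ 0 := Finset.prod_ne_zero_iff.2 fun k _ ↦ hD k
  have hdeg : R.natDegree < μ + 1 := by
    refine Nat.lt_succ_of_le ((natDegree_prod_le _ _).trans ?_)
    refine (Finset.sum_le_card_nsmul _ _ 1 fun c _ ↦ ?_).trans (by simp [hμ])
    exact natDegree_X_sub_C_le _
  have hPτ : ∀ τ α, P.evalEval (kleinJ τ) α = D₀.eval (kleinJ τ) * ∏ c, (α - ψ c τ) := by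
    intro τ α
    have h1 : ∏ c, (α - ψ c τ) = (R.map (Pi.evalRingHom (fun _ ↦ ℂ) τ)).eval α := by
      rw [hRτ, eval_prod]; simp
    rw [h1, eval_eq_sum_range' (natDegree_map_le.trans_lt hdeg), hP, evalEval_finsetSum,
      Finset.mul_sum]
    refine Finset.sum_congr rfl fun k hk ↦ ?_
    have h2 : D₀ = D k * ∏ i ∈ (Finset.range (μ + 1)).erase k, D i :=
      (Finset.mul_prod_erase _ _ hk).symm
    rw [h2, coeff_map, ← C_mul_X_pow_eq_monomial]
    simp only [evalEval_mul, evalEval_C, eval_mul, evalEval_pow, evalEval_X, Pi.evalRingHom_apply,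
      ← hQ]
    ring
  have h1 : ∀ τ, ψ ((1 : SL(2, ℤ)) : SL(2, ℤ) ⧸ Gamma0 N) τ = φ τ := fun τ ↦ by
    have : ψ ((1 : SL(2, ℤ)) : SL(2, ℤ) ⧸ Gamma0 N) τ = φ ((1 : SL(2, ℤ))⁻¹ • τ) := hwd 1 τ
    rw [this, inv_one, one_smul]
  refine ⟨P, D₀, hD₀, ?_, ?_, fun τ ↦ ?_, fun τ α hDτ hα ↦ ?_⟩
  · refine natDegree_sum_le_of_forall_le _ _ fun k hk ↦ (natDegree_monomial_le _).trans ?_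
    exact Nat.lt_succ_iff.1 (Finset.mem_range.1 hk)
  · intro h0
    obtain ⟨β, hβ⟩ := Infinite.exists_notMem_finset D₀.roots.toFinset
    replace hβ : D₀.eval β ≠ 0 := by simpa [hD₀] using hβ
    obtain ⟨τ, rfl⟩ := kleinJ_surjective β
    obtain ⟨α, hα⟩ := Infinite.exists_notMem_finset (Finset.univ.image fun c ↦ ψ c τ)
    have := hPτ τ α
    rw [h0, evalEval_zero, eq_comm, mul_eq_zero, Finset.prod_eq_zero_iff] at this
    obtain ⟨c, -, hc⟩ := this.resolve_left hβ
    exact hα (Finset.mem_image.2 ⟨c, Finset.mem_univ _, (sub_eq_zero.1 hc).symm⟩)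
  · rw [hPτ, Finset.prod_eq_zero (Finset.mem_univ ((1 : SL(2, ℤ)) : SL(2, ℤ) ⧸ Gamma0 N)), mul_zero]
    rw [h1, sub_self]
  · rw [hPτ, mul_eq_zero, Finset.prod_eq_zero_iff] at hα
    obtain ⟨c, -, hc⟩ := hα.resolve_left hDτ
    exact ⟨c.out⁻¹, (sub_eq_zero.1 hc).symm⟩

end TranslateProduct

/-! ### Relations between `x` and `j` as identities of meromorphic functions -/

section Relations

variable {W : WeierstrassCurve ℚ} {N : ℕ}
  {f : CuspForm (Gamma0 N : Subgroup (GL (Fin 2) ℝ)) 2} {Λ : PeriodPair}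

/-- The translated Eichler integral stays finite at `q = 0`, so composing it with `℘` creates no
essential singularity there. -/
lemma xFun_smul_mem_meroRing [NeZero N] (W : WeierstrassCurve ℚ)
    (f : CuspForm (Gamma0 N : Subgroup (GL (Fin 2) ℝ)) 2) (Λ : PeriodPair) (M : SL(2, ℤ)) :
    (fun τ ↦ xFun W f Λ (M • τ)) ∈ meroRing N := by
  have hN : (0 : ℝ) < N := by exact_mod_cast NeZero.pos N
  obtain ⟨G, hG, hGτ⟩ := exists_eichlerIntegral_smul_eq f M
  have hmer : ∀ q ∈ Metric.ball (0 : ℂ) 1,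
      MeromorphicAt (fun q ↦ Λ.weierstrassP (G q) - (W.b₂ : ℂ) / 12) q := fun q hq ↦
    ((Λ.meromorphic_weierstrassP (G q)).comp_analyticAt (hG q hq)).sub (.const _ _)
  refine mem_meroRing.2 ⟨fun τ ↦ ?_, _, hmer 0 (by simp), Eventually.of_forall fun τ ↦ ?_⟩
  · have hq : 𝕢 N τ ∈ Metric.ball (0 : ℂ) 1 := by
      simpa using Function.Periodic.norm_qParam_lt_one hN τ.im_pos
    refine ((hmer _ hq).comp_analyticAt
      ((Function.Periodic.differentiable_qParam (h := N)).analyticAt τ)).congr ?_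
    filter_upwards [nhdsWithin_le_nhds (isOpen_upperHalfPlaneSet.mem_nhds τ.im_pos)] with z hz
    simp only [Function.comp, xFun, hGτ, ofComplex_apply_of_im_pos hz]
  · simp only [xFun, hGτ]

lemma xFun_smul (h : IsOptimalParametrization W N f Λ) {A : SL(2, ℤ)} (hA : A ∈ Gamma0 N) (τ : ℍ) :
    xFun W f Λ (A • τ) = xFun W f Λ τ := by
  have h1 : eichlerIntegral f (A • τ) - eichlerIntegral f τ ∈ (Λ.lattice : Set ℂ) := by
    rw [h.periods_eq]; exact ⟨A, hA, τ, rfl⟩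
  have h2 := Λ.weierstrassP_add_coe (eichlerIntegral f τ) ⟨_, h1⟩
  simp only [add_sub_cancel] at h2
  rw [xFun, xFun, h2]

lemma meromorphicAt_xFun [NeZero N] (W : WeierstrassCurve ℚ)
    (f : CuspForm (Gamma0 N : Subgroup (GL (Fin 2) ℝ)) 2) (Λ : PeriodPair) (τ : ℍ) :
    MeromorphicAt (fun z ↦ xFun W f Λ (ofComplex z)) τ := by
  simpa using (mem_meroRing.1 (xFun_smul_mem_meroRing W f Λ 1)).1 τ

/-- `℘` has the default value `0` at lattice points, so all poles share one artificial value of `x`;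
avoiding this value avoids the poles. -/
lemma xFun_of_isPole {τ : ℍ} (hτ : IsPole f Λ τ) : xFun W f Λ τ = - (W.b₂ : ℂ) / 12 := by
  have := Λ.weierstrassP_coe ⟨_, hτ⟩
  rw [xFun, this]; ring

/-- The function `G(x, j)` on the upper half-plane. -/
def relFun (W : WeierstrassCurve ℚ) (f : ℍ → ℂ) (Λ : PeriodPair) (G : ℂ[X][X]) (z : ℂ) : ℂ :=
  G.evalEval (kleinJ (ofComplex z)) (xFun W f Λ (ofComplex z))

lemma meromorphicAt_relFun [NeZero N] (W : WeierstrassCurve ℚ)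
    (f : CuspForm (Gamma0 N : Subgroup (GL (Fin 2) ℝ)) 2) (Λ : PeriodPair) (G : ℂ[X][X]) (τ : ℍ) :
    MeromorphicAt (relFun W f Λ G) τ := by
  have hj : ∀ P : ℂ[X], MeromorphicAt (fun z ↦ P.eval (kleinJ (ofComplex z))) (τ : ℂ) :=
    fun P ↦ (mem_meroRing.1 (eval_mem_meroRing (kleinJ_mem_meroRing N) P)).1 τ
  have : relFun W f Λ G = fun z ↦ ∑ k ∈ Finset.range (G.natDegree + 1),
      (G.coeff k).eval (kleinJ (ofComplex z)) * xFun W f Λ (ofComplex z) ^ k := by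
    ext z
    rw [relFun, ← eval₂_evalRingHom, eval₂_eq_sum_range]
    rfl
  rw [this]
  exact MeromorphicAt.fun_sum fun k _ ↦ (hj _).mul ((meromorphicAt_xFun W f Λ τ).pow k)

lemma analyticAt_eichlerIntegral (f : CuspForm (Gamma0 N : Subgroup (GL (Fin 2) ℝ)) 2) (τ : ℍ) :
    AnalyticAt ℂ (fun z ↦ eichlerIntegral f (ofComplex z)) τ := by
  obtain ⟨-, -, -, -, hγ⟩ := exists_eichlerIntegral_eq f
  have : DifferentiableOn ℂ (fun z ↦ eichlerIntegral f (ofComplex z)) upperHalfPlaneSet := by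
    intro z hz
    lift z to ℍ using hz
    exact (hγ z).differentiableAt.differentiableWithinAt
  exact this.analyticAt (isOpen_upperHalfPlaneSet.mem_nhds τ.im_pos)

lemma isPreconnected_upperHalfPlaneSet : IsPreconnected upperHalfPlaneSet :=
  (convex_halfSpace_im_gt 0).isPreconnected

/-- `Λ` is discrete, so poles could accumulate only if `γ` were constant. Then all its periods would
vanish, although `ω₁` is a nonzero period. -/
lemma eventually_not_isPole (h : IsOptimalParametrization W N f Λ) (τ : ℍ) :
    ∀ᶠ z in 𝓝[≠] (τ : ℂ), ¬ IsPole f Λ (ofComplex z) := by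
  have hγ := analyticAt_eichlerIntegral f τ
  have h1 : ∀ᶠ z in 𝓝[≠] (τ : ℂ), eichlerIntegral f (ofComplex z) ∉
      (Λ.lattice : Set ℂ) \ {eichlerIntegral f τ} := by
    have := hγ.continuousAt.eventually (Λ.compl_lattice_sdiff_singleton_mem_nhds _)
    simp only [ofComplex_apply] at this
    exact nhdsWithin_le_nhds this
  rcases hγ.eventually_eq_or_eventually_ne
    (analyticAt_const (𝕜 := ℂ) (v := eichlerIntegral f τ)) with h2 | h2
  · exfalso
    have h3 : EqOn (fun z ↦ eichlerIntegral f (ofComplex z)) (fun _ ↦ eichlerIntegral f τ)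
        upperHalfPlaneSet := by
      refine AnalyticOnNhd.eqOn_of_preconnected_of_eventuallyEq (𝕜 := ℂ) (fun z hz ↦ ?_)
        analyticOnNhd_const isPreconnected_upperHalfPlaneSet τ.im_pos h2
      lift z to ℍ using hz
      exact analyticAt_eichlerIntegral f z
    have h4 : ∀ σ : ℍ, eichlerIntegral f σ = eichlerIntegral f τ := fun σ ↦ by
      simpa using h3 σ.im_pos
    have h5 : Λ.ω₁ ∈ (Λ.lattice : Set ℂ) := Λ.ω₁_mem_lattice
    rw [h.periods_eq] at h5
    obtain ⟨M, -, σ, h6⟩ := h5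
    rw [h4, h4 σ, sub_self] at h6
    exact Λ.ω₁_div_two_notMem_lattice (by rw [h6]; simp)
  · filter_upwards [h1, h2] with z hz1 hz2 hz3
    exact hz1 ⟨hz3, hz2⟩

lemma continuousAt_relFun (W : WeierstrassCurve ℚ) (G : ℂ[X][X]) {τ : ℍ} (hτ : ¬ IsPole f Λ τ) :
    ContinuousAt (relFun W f Λ G) τ := by
  have hγ := (analyticAt_eichlerIntegral f τ).continuousAt
  have hx : ContinuousAt (fun z ↦ xFun W f Λ (ofComplex z)) τ := by
    have h1 : ContinuousAt Λ.weierstrassP (eichlerIntegral f (ofComplex τ)) := by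
      rw [ofComplex_apply]
      exact (Λ.analyticOnNhd_weierstrassP _ hτ).continuousAt
    exact (ContinuousAt.comp (f := fun z ↦ eichlerIntegral f (ofComplex z)) h1 hγ).sub
      continuousAt_const
  have hj := (analyticAt_comp_ofComplex mdiff_kleinJ τ).continuousAt
  have : relFun W f Λ G = fun z ↦ ∑ k ∈ Finset.range (G.natDegree + 1),
      (G.coeff k).eval (kleinJ (ofComplex z)) * xFun W f Λ (ofComplex z) ^ k := by
    ext z
    rw [relFun, ← eval₂_evalRingHom, eval₂_eq_sum_range]
    rfl
  rw [this]
  refine tendsto_finsetSum _ fun k _ ↦ ?_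
  exact (((G.coeff k).continuous.continuousAt.comp hj).mul (hx.pow k))

/-- The poles are isolated and the function is continuous off them, so vanishing of values and
vanishing of germs are interchangeable. -/
lemma isRelation_iff_forall (h : IsOptimalParametrization W N f Λ) (G : ℂ[X][X]) :
    IsRelation W f Λ G ↔ ∀ τ : ℍ, meromorphicOrderAt (relFun W f Λ G) τ = ⊤ := by
  refine ⟨fun hG τ ↦ meromorphicOrderAt_eq_top_iff.2 ?_, fun hG τ hτ ↦ ?_⟩
  · filter_upwards [eventually_not_isPole h τ] with z hz
    exact hG _ hz
  · have h1 := meromorphicOrderAt_eq_top_iff.1 (hG τ)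
    have h2 : Tendsto (relFun W f Λ G) (𝓝[≠] (τ : ℂ)) (𝓝 0) :=
      tendsto_const_nhds.congr' (h1.mono fun z hz ↦ hz.symm)
    have h3 := (continuousAt_relFun W G hτ).tendsto.mono_left
      (nhdsWithin_le_nhds (s := {(τ : ℂ)}ᶜ))
    have := tendsto_nhds_unique h3 h2
    simpa [relFun] using this

/-- The identity theorem on the connected set `ℍ`: one vanishing germ suffices. -/
lemma isRelation_iff_exists [NeZero N] (h : IsOptimalParametrization W N f Λ) (G : ℂ[X][X]) :
    IsRelation W f Λ G ↔ ∃ τ : ℍ, meromorphicOrderAt (relFun W f Λ G) τ = ⊤ := by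
  rw [isRelation_iff_forall h]
  refine ⟨fun hG ↦ ⟨I, hG I⟩, fun ⟨τ, hτ⟩ ↦ ?_⟩
  by_contra! hne
  obtain ⟨σ, hσ⟩ := hne
  have hm : MeromorphicOn (relFun W f Λ G) upperHalfPlaneSet := fun z hz ↦ by
    lift z to ℍ using hz
    exact meromorphicAt_relFun W f Λ G z
  exact hm.meromorphicOrderAt_ne_top_of_isPreconnected isPreconnected_upperHalfPlaneSet
    σ.im_pos τ.im_pos hσ hτ

lemma IsRelation.of_mul [NeZero N] (h : IsOptimalParametrization W N f Λ) {G H : ℂ[X][X]}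
    (hGH : IsRelation W f Λ (G * H)) : IsRelation W f Λ G ∨ IsRelation W f Λ H := by
  have h1 := (isRelation_iff_forall h _).1 hGH I
  have h2 : relFun W f Λ (G * H) = relFun W f Λ G * relFun W f Λ H := by
    ext z; simp [relFun, evalEval_mul]
  rw [h2, meromorphicOrderAt_mul (meromorphicAt_relFun W f Λ G I)
    (meromorphicAt_relFun W f Λ H I), WithTop.add_eq_top] at h1
  exact h1.imp (fun h3 ↦ (isRelation_iff_exists h G).2 ⟨I, h3⟩)
    (fun h3 ↦ (isRelation_iff_exists h H).2 ⟨I, h3⟩)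

/-- This is the transcendence of `j`: it takes every complex value, so a polynomial vanishing on its
values is zero. -/
lemma IsRelation.eq_zero_of_C (h : IsOptimalParametrization W N f Λ) {c : ℂ[X]}
    (hc : IsRelation W f Λ (C c)) : c = 0 := by
  have hall : ∀ τ, c.eval (kleinJ τ) = 0 := by
    intro τ
    have h1 := meromorphicOrderAt_eq_top_iff.1 ((isRelation_iff_forall h _).1 hc τ)
    have hj : ContinuousAt (fun z ↦ c.eval (kleinJ (ofComplex z))) (τ : ℂ) :=
      c.continuous.continuousAt.comp (analyticAt_comp_ofComplex mdiff_kleinJ τ).continuousAt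
    have h2 : Tendsto (fun z ↦ c.eval (kleinJ (ofComplex z))) (𝓝[≠] (τ : ℂ)) (𝓝 0) :=
      tendsto_const_nhds.congr' (h1.mono fun z hz ↦ by
      rw [relFun, evalEval_C] at hz
      exact hz.symm)
    have := tendsto_nhds_unique (hj.tendsto.mono_left nhdsWithin_le_nhds) h2
    simpa using this
  refine Polynomial.funext fun β ↦ ?_
  obtain ⟨τ, rfl⟩ := kleinJ_surjective β
  simpa using hall τ

lemma IsRelation.mul_left {f : ℍ → ℂ} (G : ℂ[X][X]) {H : ℂ[X][X]} (hH : IsRelation W f Λ H) :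
    IsRelation W f Λ (G * H) := fun τ hτ ↦ by
  rw [evalEval_mul, hH τ hτ, mul_zero]

lemma IsRelation.sub {f : ℍ → ℂ} {G H : ℂ[X][X]} (hG : IsRelation W f Λ G)
    (hH : IsRelation W f Λ H) : IsRelation W f Λ (G - H) := fun τ hτ ↦ by
  rw [evalEval_sub, hG τ hτ, hH τ hτ, sub_zero]

end Relations

/-! ### Germs with rational Taylor coefficients -/

section RationalTaylor

lemma exists_eq_X_pow_mul_of_eventuallyEq {m : ℕ} {r : ℂ[X]} {a : ℂ → ℂ} (ha : ContinuousAt a 0)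
    (h : ∀ᶠ z in 𝓝[≠] (0 : ℂ), r.eval z = z ^ m * a z) :
    ∃ s : ℂ[X], r = X ^ m * s ∧ s.coeff 0 = a 0 := by
  induction m generalizing r with
  | zero =>
    refine ⟨r, by simp, ?_⟩
    rw [coeff_zero_eq_eval_zero]
    refine tendsto_nhds_unique (r.continuous.continuousAt.tendsto.mono_left nhdsWithin_le_nhds)
      ((ha.tendsto.mono_left (nhdsWithin_le_nhds (s := {(0 : ℂ)}ᶜ))).congr' ?_)
    filter_upwards [h] with z hz
    simp [hz]
  | succ m ih =>
    have h0 : r.eval 0 = 0 := by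
      have h1 : Tendsto (fun z : ℂ ↦ z ^ (m + 1) * a z) (𝓝[≠] 0) (𝓝 (0 ^ (m + 1) * a 0)) :=
        (((continuous_pow (m + 1)).continuousAt).mul ha).tendsto.mono_left nhdsWithin_le_nhds
      have h2 := tendsto_nhds_unique
        (r.continuous.continuousAt.tendsto.mono_left nhdsWithin_le_nhds)
        (h1.congr' (h.mono fun z hz ↦ hz.symm))
      simpa using h2
    obtain ⟨r', rfl⟩ : (X : ℂ[X]) ∣ r := X_dvd_iff.2 (by rwa [coeff_zero_eq_eval_zero])
    obtain ⟨s, rfl, hs⟩ := ih (r := r') (by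
      filter_upwards [h, self_mem_nhdsWithin] with z hz hz0
      have hz0 : z ≠ 0 := hz0
      rw [eval_mul, eval_X, pow_succ'] at hz
      exact mul_left_cancel₀ hz0 (by rw [hz]; ring))
    exact ⟨s, by ring, hs⟩

/-- Here `a 0` is the coefficient of `X ^ m` in `r`. This is the comparison of coefficients by which
each new Taylor coefficient is shown to be rational. -/
lemma apply_mem_range_of_eventuallyEq {m : ℕ} {r : ℚ[X]} {a : ℂ → ℂ} (ha : ContinuousAt a 0)
    (h : ∀ᶠ z in 𝓝[≠] (0 : ℂ), aeval z r = z ^ m * a z) : ∃ c : ℚ, a 0 = c := by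
  obtain ⟨s, hs, hs0⟩ := exists_eq_X_pow_mul_of_eventuallyEq (m := m)
    (r := r.map (algebraMap ℚ ℂ)) ha (by simpa [eval_map_algebraMap] using h)
  refine ⟨r.coeff m, ?_⟩
  have := congrArg (coeff · m) hs
  simp only [coeff_map, eq_ratCast, coeff_X_pow_mul', le_refl, if_true, Nat.sub_self] at this
  rw [← hs0, this]

/-- The ring of functions that agree near `0`, outside `0`, with an analytic function whose Taylor
coefficients are rational numbers. -/
def ratTaylor : Subring (ℂ → ℂ) where
  carrier := {f | ∀ n : ℕ, ∃ (p : ℚ[X]) (w : ℂ → ℂ), AnalyticAt ℂ w 0 ∧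
    ∀ᶠ z in 𝓝[≠] (0 : ℂ), f z = aeval z p + z ^ n * w z}
  zero_mem' n := ⟨0, 0, analyticAt_const, by simp⟩
  one_mem' n := ⟨1, 0, analyticAt_const, by simp⟩
  add_mem' {f g} hf hg n := by
    obtain ⟨p, w, hw, hfp⟩ := hf n
    obtain ⟨q, v, hv, hgq⟩ := hg n
    refine ⟨p + q, w + v, hw.add hv, ?_⟩
    filter_upwards [hfp, hgq] with z h1 h2
    simp only [Pi.add_apply, h1, h2, map_add]
    ring
  neg_mem' {f} hf n := by
    obtain ⟨p, w, hw, hfp⟩ := hf n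
    refine ⟨-p, -w, hw.neg, ?_⟩
    filter_upwards [hfp] with z h1
    simp only [Pi.neg_apply, h1, map_neg]
    ring
  mul_mem' {f g} hf hg n := by
    obtain ⟨p, w, hw, hfp⟩ := hf n
    obtain ⟨q, v, hv, hgq⟩ := hg n
    have hp : AnalyticAt ℂ (fun z ↦ aeval z p) (0 : ℂ) := analyticAt_id.aeval_polynomial p
    have hq : AnalyticAt ℂ (fun z ↦ aeval z q) (0 : ℂ) := analyticAt_id.aeval_polynomial q
    refine ⟨p * q, fun z ↦ aeval z p * v z + w z * aeval z q + z ^ n * w z * v z,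
      ((hp.mul hv).add (hw.mul hq)).add (((analyticAt_id.pow n).mul hw).mul hv), ?_⟩
    filter_upwards [hfp, hgq] with z h1 h2
    simp only [Pi.mul_apply, h1, h2, map_mul]
    ring

lemma mem_ratTaylor_congr {f g : ℂ → ℂ} (hf : f ∈ ratTaylor) (h : f =ᶠ[𝓝[≠] 0] g) :
    g ∈ ratTaylor := fun n ↦ by
  obtain ⟨p, w, hw, hfp⟩ := hf n
  refine ⟨p, w, hw, ?_⟩
  filter_upwards [hfp, h] with z h1 h2
  rw [← h2, h1]

lemma aeval_mem_ratTaylor (p : ℚ[X]) : (fun z : ℂ ↦ aeval z p) ∈ ratTaylor := fun n ↦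
  ⟨p, 0, analyticAt_const, by simp⟩

lemma ratCast_mem_ratTaylor (c : ℚ) : (fun _ ↦ (c : ℂ)) ∈ ratTaylor := by
  simpa using aeval_mem_ratTaylor (C c)

/-- If `f = p + zⁿ w` with `w` analytic, then `w 0` can be moved into the polynomial part. -/
lemma exists_eq_pow_succ_of_analyticAt {f w : ℂ → ℂ} {p : ℚ[X]} {n : ℕ} {c : ℚ}
    (hw : AnalyticAt ℂ w 0) (hc : w 0 = c)
    (h : ∀ᶠ z in 𝓝[≠] (0 : ℂ), f z = aeval z p + z ^ n * w z) :
    ∃ (p : ℚ[X]) (w : ℂ → ℂ), AnalyticAt ℂ w 0 ∧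
      ∀ᶠ z in 𝓝[≠] (0 : ℂ), f z = aeval z p + z ^ (n + 1) * w z := by
  refine ⟨p + C c * X ^ n, dslope w 0, ?_, ?_⟩
  · obtain ⟨P, hP⟩ := hw
    exact ⟨_, hP.has_fpower_series_dslope_fslope⟩
  · filter_upwards [h, self_mem_nhdsWithin] with z hz hz0
    have : w z = c + z * dslope w 0 z := by
      have := sub_smul_dslope w 0 z
      rw [sub_zero, smul_eq_mul, hc] at this
      rw [this]; ring
    rw [hz, this]
    simp only [map_add, map_mul, aeval_C, aeval_X, eq_ratCast, map_pow]
    ring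

lemma mem_ratTaylor_of_coeff {f : ℂ → ℂ} {P : FormalMultilinearSeries ℂ ℂ ℂ}
    (hf : HasFPowerSeriesAt f P 0) (hP : ∀ n, ∃ c : ℚ, P.coeff n = c) : f ∈ ratTaylor := fun n ↦ by
  induction n generalizing f P with
  | zero => exact ⟨0, f, ⟨P, hf⟩, by simp⟩
  | succ n ih =>
    obtain ⟨p, w, hw, h⟩ := ih hf.has_fpower_series_dslope_fslope fun n ↦ by
      rw [FormalMultilinearSeries.coeff_fslope]; exact hP _
    obtain ⟨c, hc⟩ := hP 0
    have hf0 : f 0 = c := by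
      rw [← hc]; exact (hf.coeff_zero 1).symm
    refine ⟨X * p + C c, w, hw, ?_⟩
    filter_upwards [h] with z hz
    have := sub_smul_dslope f 0 z
    rw [sub_zero, smul_eq_mul, hf0, hz] at this
    rw [sub_eq_iff_eq_add.1 this.symm]
    simp only [map_add, map_mul, aeval_C, aeval_X, eq_ratCast]
    ring

lemma comp_mem_ratTaylor {f g : ℂ → ℂ} (hf : f ∈ ratTaylor) (hg : g ∈ ratTaylor)
    (hga : AnalyticAt ℂ g 0) (hg0 : g 0 = 0) (hne : ∀ᶠ z in 𝓝[≠] (0 : ℂ), g z ≠ 0) :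
    (fun z ↦ f (g z)) ∈ ratTaylor := fun n ↦ by
  obtain ⟨p, w, hw, hfp⟩ := hf n
  have hpg : (fun z ↦ aeval (g z) p) ∈ ratTaylor := by
    have : (fun z ↦ aeval (g z) p) = ∑ i ∈ Finset.range (p.natDegree + 1),
        (fun _ ↦ ((p.coeff i : ℚ) : ℂ)) * g ^ i := by
      ext z
      rw [aeval_eq_sum_range]
      simp [Algebra.smul_def]
    rw [this]
    exact sum_mem fun i _ ↦ mul_mem (ratCast_mem_ratTaylor _) (pow_mem hg i)
  obtain ⟨q, v, hv, hq⟩ := hpg n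
  have hd : AnalyticAt ℂ (dslope g 0) 0 := by
    obtain ⟨P, hP⟩ := hga
    exact ⟨_, hP.has_fpower_series_dslope_fslope⟩
  have ht : Tendsto g (𝓝[≠] 0) (𝓝[≠] 0) := by
    refine tendsto_nhdsWithin_iff.2 ⟨?_, hne⟩
    have := hga.continuousAt.tendsto
    rw [hg0] at this
    exact this.mono_left nhdsWithin_le_nhds
  have hwg : AnalyticAt ℂ (fun z ↦ w (g z)) 0 :=
    AnalyticAt.fun_comp (g := w) (f := g) (by rwa [hg0]) hga
  refine ⟨q, fun z ↦ v z + dslope g 0 z ^ n * w (g z), hv.add ((hd.pow n).mul hwg), ?_⟩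
  filter_upwards [hq, ht.eventually hfp] with z h1 h2
  have h3 := sub_smul_dslope g 0 z
  rw [sub_zero, smul_eq_mul, hg0, sub_zero] at h3
  have h1 : aeval (g z) p = aeval z q + z ^ n * v z := h1
  rw [h2, h1]
  nth_rewrite 1 [← h3]
  ring

lemma mul_deriv_eventuallyEq {f w : ℂ → ℂ} {p : ℚ[X]} {n : ℕ} (hw : AnalyticAt ℂ w 0)
    (h : ∀ᶠ z in 𝓝[≠] (0 : ℂ), f z = aeval z p + z ^ n * w z) :
    ∀ᶠ z in 𝓝[≠] (0 : ℂ), z * deriv f z =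
      z * aeval z (derivative p) + n * (z ^ n * w z) + z ^ (n + 1) * deriv w z := by
  filter_upwards [eventually_eventually_nhdsWithin.2 h,
    nhdsWithin_le_nhds hw.eventually_analyticAt, self_mem_nhdsWithin] with z hz hwz hz0
  have h1 : f =ᶠ[𝓝 z] fun z ↦ aeval z p + z ^ n * w z := by
    rwa [IsOpen.nhdsWithin_eq isOpen_compl_singleton hz0] at hz
  rw [h1.deriv_eq]
  have h3 : HasDerivAt (fun z : ℂ ↦ z ^ n) (n * z ^ (n - 1)) z := hasDerivAt_pow n z
  have h2 : HasDerivAt (fun z : ℂ ↦ aeval z p + z ^ n * w z) (aeval z (derivative p) +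
      (n * z ^ (n - 1) * w z + z ^ n * deriv w z)) z :=
    (p.hasDerivAt_aeval z).add (h3.mul hwz.differentiableAt.hasDerivAt)
  rw [h2.deriv]
  cases n <;> simp <;> ring

/-- The operator `z d/dz` multiplies the `n`-th coefficient by `n`, which can be divided out for `n
> 0`; the constant term is supplied by `hg0`. -/
lemma mem_ratTaylor_of_deriv {g : ℂ → ℂ} (hg : AnalyticAt ℂ g 0) {c : ℚ} (hg0 : g 0 = c)
    (h : (fun z ↦ z * deriv g z) ∈ ratTaylor) : g ∈ ratTaylor := fun n ↦ by
  induction n with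
  | zero => exact ⟨0, g, hg, by simp⟩
  | succ n ih =>
    obtain ⟨p, w, hw, hgp⟩ := ih
    rcases n.eq_zero_or_pos with rfl | hn
    · have : w 0 = (c - p.coeff 0 : ℚ) := by
        have h1 : ∀ᶠ z in 𝓝[≠] (0 : ℂ), w z = g z - aeval z p := by
          filter_upwards [hgp] with z hz
          rw [hz]; simp
        have h2 : ContinuousAt (fun z : ℂ ↦ g z - aeval z p) 0 :=
          (hg.sub (analyticAt_id.aeval_polynomial p)).continuousAt
        have h3 := tendsto_nhds_unique
          (hw.continuousAt.tendsto.mono_left (nhdsWithin_le_nhds (s := {(0 : ℂ)}ᶜ)))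
          ((h2.tendsto.mono_left (nhdsWithin_le_nhds (s := {(0 : ℂ)}ᶜ))).congr'
            (h1.mono fun z hz ↦ hz.symm))
        rw [h3, hg0, ← coeff_zero_eq_aeval_zero' p]
        simp
      exact exists_eq_pow_succ_of_analyticAt hw this hgp
    · obtain ⟨q, v, hv, hq⟩ := h (n + 1)
      obtain ⟨c', hc'⟩ := apply_mem_range_of_eventuallyEq (m := n)
        (r := q - X * derivative p) (a := fun z ↦ n * w z + z * deriv w z - z * v z)
        (((continuousAt_const.mul hw.continuousAt).add
          (continuousAt_id.mul hw.deriv.continuousAt)).sub (continuousAt_id.mul hv.continuousAt))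
        (by
          filter_upwards [hq, mul_deriv_eventuallyEq hw hgp] with z h1 h2
          have h3 := h1.symm.trans h2
          rw [← eq_sub_iff_add_eq] at h3
          simp only [map_sub, map_mul, aeval_X, h3]
          ring)
      simp only [zero_mul, add_zero, sub_zero] at hc'
      refine exists_eq_pow_succ_of_analyticAt hw (c := c' / n) ?_ hgp
      have : (n : ℂ) ≠ 0 := by exact_mod_cast hn.ne'
      push_cast
      rw [← hc']; field_simp

/-- With `u = z² ℘` one has `z³ ℘' = z u' - 2 u`, so this is the equation of `℘` multiplied by `z⁶`.
Given `u 0 = 1`, an unknown coefficient at `zᵐ` enters the comparison at order `m` linearly, with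
factor `4(m - 2) + 12 = 4m + 4 ≠ 0`, and is thus determined rationally by the earlier ones. -/
lemma mem_ratTaylor_of_ode {u : ℂ → ℂ} (hu : AnalyticAt ℂ u 0) (hu0 : u 0 = 1) (a b : ℚ)
    (h : ∀ᶠ z in 𝓝[≠] (0 : ℂ),
      (z * deriv u z - 2 * u z) ^ 2 = 4 * u z ^ 3 - a * z ^ 4 * u z - b * z ^ 6) :
    u ∈ ratTaylor := by
  -- The exponent `n + 1 ≥ 1` makes the terms of higher degree in `w` vanish at `0`, and `p.coeff 0
  -- = 1` keeps the linear factor explicit.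
  suffices H : ∀ n : ℕ, ∃ (p : ℚ[X]) (w : ℂ → ℂ), AnalyticAt ℂ w 0 ∧ p.coeff 0 = 1 ∧
      ∀ᶠ z in 𝓝[≠] (0 : ℂ), u z = aeval z p + z ^ (n + 1) * w z by
    intro n
    obtain ⟨p, w, hw, -, h⟩ := H n
    refine ⟨p, fun z ↦ z * w z, analyticAt_id.mul hw, ?_⟩
    filter_upwards [h] with z hz
    rw [hz]; ring
  intro n
  induction n with
  | zero =>
    refine ⟨1, dslope u 0, ?_, by simp, Eventually.of_forall fun z ↦ ?_⟩
    · obtain ⟨P, hP⟩ := hu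
      exact ⟨_, hP.has_fpower_series_dslope_fslope⟩
    · have := sub_smul_dslope u 0 z
      rw [sub_zero, smul_eq_mul, hu0] at this
      simp [this]
  | succ n ih =>
    obtain ⟨p, w, hw, hp0, hup⟩ := ih
    have hp : AnalyticAt ℂ (fun z ↦ aeval z p) (0 : ℂ) := analyticAt_id.aeval_polynomial p
    have hp' : AnalyticAt ℂ (fun z ↦ aeval z (derivative p)) (0 : ℂ) :=
      analyticAt_id.aeval_polynomial _
    set m := n + 1 with hm
    have hwc := hw.continuousAt
    have hwc' := hw.deriv.continuousAt
    have hpc := hp.continuousAt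
    have hpc' := hp'.continuousAt
    obtain ⟨c, hc⟩ := apply_mem_range_of_eventuallyEq (m := m)
      (r := (X * derivative p - 2 * p) ^ 2 - 4 * p ^ 3 + C a * X ^ 4 * p + C b * X ^ 6)
      (a := fun z ↦ -(2 * (z * aeval z (derivative p) - 2 * aeval z p) *
          (((m : ℂ) - 2) * w z + z * deriv w z) +
          z ^ m * (((m : ℂ) - 2) * w z + z * deriv w z) ^ 2
          - 12 * aeval z p ^ 2 * w z - 12 * aeval z p * z ^ m * w z ^ 2
          - 4 * z ^ (2 * m) * w z ^ 3 + a * z ^ 4 * w z))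
      (by fun_prop)
      (by
        filter_upwards [h, hup, mul_deriv_eventuallyEq hw hup] with z h1 h2 h3
        rw [h3, h2] at h1
        simp only [map_sub, map_mul, map_add, map_pow, aeval_X, aeval_C, eq_ratCast, map_ofNat]
        linear_combination (exp := 1) h1)
    simp only [← coeff_zero_eq_aeval_zero', hp0] at hc
    have hm0 : (0 : ℂ) ^ m = 0 := by simp [hm]
    have hm1 : (0 : ℂ) ^ (2 * m) = 0 := by simp [hm]
    simp only [hm0, hm1, map_one, zero_mul, mul_zero, ne_eq, OfNat.ofNat_ne_zero,
      not_false_eq_true, zero_pow] at hc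
    have hm2 : ((4 * m + 4 : ℕ) : ℂ) ≠ 0 := Nat.cast_ne_zero.2 (by omega)
    obtain ⟨q, v, hv, hq⟩ := exists_eq_pow_succ_of_analyticAt hw (c := c / (4 * m + 4 : ℕ)) (by
      push_cast at hm2 ⊢
      rw [← hc]; field_simp; ring) hup
    refine ⟨q, v, hv, ?_, hq⟩
    obtain ⟨s, hs, -⟩ := exists_eq_X_pow_mul_of_eventuallyEq (m := 1)
      (r := (q - p).map (algebraMap ℚ ℂ)) (a := fun z ↦ z ^ n * w z - z ^ (n + 1) * v z)
      ((by have := hv.continuousAt; fun_prop)) (by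
        filter_upwards [hup, hq] with z h1 h2
        have h3 := h1.symm.trans h2
        rw [eval_map_algebraMap, map_sub, sub_eq_iff_eq_add]
        rw [← sub_eq_iff_eq_add] at h3
        rw [← h3, hm]; ring)
    have := congrArg (coeff · 0) hs
    simp only [coeff_map, coeff_sub, pow_one, coeff_X_mul_zero, eq_ratCast, Rat.cast_eq_zero,
      hp0] at this
    linarith

/-- Each Taylor coefficient of the sum is a `ℚ`-linear combination of the `c i`, so `l` carries its
vanishing over to the new sum, which then vanishes to every order. -/
lemma sum_apply_mul_eventuallyEq_zero {ι : Type*} (s : Finset ι) (c : ι → ℂ) (m : ι → ℂ → ℂ)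
    (hm : ∀ i, m i ∈ ratTaylor) (h : ∀ᶠ z in 𝓝[≠] (0 : ℂ), ∑ i ∈ s, c i * m i z = 0)
    (l : ℂ →ₗ[ℚ] ℚ) : ∀ᶠ z in 𝓝[≠] (0 : ℂ), ∑ i ∈ s, (l (c i) : ℂ) * m i z = 0 := by
  have key : ∀ n : ℕ, ∃ w : ℂ → ℂ, AnalyticAt ℂ w 0 ∧
      ∀ᶠ z in 𝓝[≠] (0 : ℂ), ∑ i ∈ s, (l (c i) : ℂ) * m i z = z ^ n * w z := by
    intro n
    choose p w hw hp using fun i ↦ hm i n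
    have hall : ∀ᶠ z in 𝓝[≠] (0 : ℂ), ∀ i ∈ s, m i z = aeval z (p i) + z ^ n * w i z :=
      (Filter.eventually_all_finset s).2 fun i _ ↦ hp i
    obtain ⟨r, hr, -⟩ := exists_eq_X_pow_mul_of_eventuallyEq (m := n)
      (r := ∑ i ∈ s, C (c i) * (p i).map (algebraMap ℚ ℂ))
      (a := fun z ↦ -∑ i ∈ s, c i * w i z)
      (tendsto_finsetSum _ fun i _ ↦ continuousAt_const.mul (hw i).continuousAt).neg (by
        filter_upwards [h, hall] with z h1 h2
        rw [Finset.sum_congr rfl fun i hi ↦ by rw [h2 i hi]] at h1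
        simp only [mul_add, Finset.sum_add_distrib] at h1
        simp only [eval_finsetSum, eval_mul, eval_C, eval_map_algebraMap, mul_neg,
          Finset.mul_sum]
        rw [eq_neg_iff_add_eq_zero, ← h1]
        congr 1
        exact Finset.sum_congr rfl fun i _ ↦ by ring)
    have hdvd : X ^ n ∣ ∑ i ∈ s, C (l (c i)) * p i := by
      rw [X_pow_dvd_iff]
      intro k hk
      have h1 := congrArg (coeff · k) hr
      simp only [finsetSum_coeff, coeff_C_mul, coeff_map, eq_ratCast, coeff_X_pow_mul',
        not_le.2 hk, if_false] at h1
      have h2 := congrArg l h1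
      simp only [map_sum, map_zero] at h2
      rw [finsetSum_coeff, ← h2]
      refine Finset.sum_congr rfl fun i _ ↦ ?_
      rw [coeff_C_mul, mul_comm (c i), ← Rat.smul_def, map_smul, smul_eq_mul, mul_comm]
    obtain ⟨t, ht⟩ := hdvd
    refine ⟨fun z ↦ aeval z t + ∑ i ∈ s, (l (c i) : ℂ) * w i z,
      (analyticAt_id.aeval_polynomial t).add
        (Finset.analyticAt_fun_sum _ fun i _ ↦ analyticAt_const.mul (hw i)), ?_⟩
    filter_upwards [hall] with z hz
    rw [Finset.sum_congr rfl fun i hi ↦ by rw [hz i hi]]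
    have h1 := congrArg (aeval z) ht
    simp only [map_sum, map_mul, aeval_C, eq_ratCast, map_pow, aeval_X] at h1
    rw [mul_add, ← h1, Finset.mul_sum]
    simp only [mul_add, Finset.sum_add_distrib]
    congr 1
    exact Finset.sum_congr rfl fun i _ ↦ by ring
  refine meromorphicOrderAt_eq_top_iff.1 ?_
  by_contra hne
  obtain ⟨k, hk⟩ := WithTop.ne_top_iff_exists.1 hne
  obtain ⟨n, hn⟩ : ∃ n : ℕ, n = k.toNat + 1 := ⟨_, rfl⟩
  obtain ⟨w, hw, h1⟩ := key n
  have h2 := meromorphicOrderAt_congr h1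
  have h3 : meromorphicOrderAt (fun z : ℂ ↦ z ^ n) 0 = (n : ℤ) := by
    refine (meromorphicOrderAt_eq_int_iff (by fun_prop)).2
      ⟨fun _ ↦ 1, analyticAt_const, one_ne_zero, ?_⟩
    exact Eventually.of_forall fun z ↦ by simp
  have h4 := meromorphicOrderAt_mul (f := fun z : ℂ ↦ z ^ n) (by fun_prop)
    hw.meromorphicAt
  have h5 := hw.meromorphicOrderAt_nonneg
  rw [show (fun z ↦ z ^ n * w z) = (fun z : ℂ ↦ z ^ n) * w from rfl, h4,
    h3, ← hk] at h2
  have h6 : ((n : ℤ) : WithTop ℤ) ≤ (k : WithTop ℤ) := by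
    rw [h2]; exact le_add_of_nonneg_right h5
  have h7 := WithTop.coe_le_coe.1 h6
  have := Int.self_le_toNat k
  omega

end RationalTaylor

/-! ### Rational `q`-expansions and descent of relations to `ℚ` -/

section RationalExpansions

lemma cuspFunction_mem_ratTaylor {f : ℍ → ℂ} (hf : AnalyticAt ℂ (cuspFunction 1 f) 0)
    (hc : ∀ n, ∃ c : ℚ, (qExpansion 1 f).coeff n = c) : cuspFunction 1 f ∈ ratTaylor := by
  refine mem_ratTaylor_of_coeff hf.hasFPowerSeriesAt fun n ↦ ?_
  obtain ⟨c, hc⟩ := hc n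
  refine ⟨c, ?_⟩
  rw [← hc, qExpansion_coeff, FormalMultilinearSeries.coeff_ofScalars, div_eq_inv_mul]

lemma exists_ratTaylor_E {k : ℕ} (hk : 3 ≤ k) (hk2 : Even k) :
    ∃ e ∈ ratTaylor, ∀ τ : ℍ, e (𝕢 1 τ) = ModularForm.E hk τ := by
  refine ⟨cuspFunction 1 (ModularForm.E hk), cuspFunction_mem_ratTaylor
    (ModularFormClass.analyticAt_cuspFunction_zero _ one_pos one_mem_strictPeriods_SL)
    fun n ↦ ?_, fun τ ↦
      SlashInvariantFormClass.eq_cuspFunction _ τ one_mem_strictPeriods_SL one_ne_zero⟩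
  rw [EisensteinSeries.E_qExpansion_coeff hk hk2]
  split_ifs
  · exact ⟨1, by simp⟩
  · exact ⟨-(2 * k / _root_.bernoulli k) * (ArithmeticFunction.sigma (k - 1) n : ℚ),
      by push_cast; rfl⟩

lemma exists_ratTaylor_discriminant :
    ∃ e ∈ ratTaylor, ∃ δ ∈ ratTaylor, (∀ τ : ℍ, e (𝕢 1 τ) = ModularForm.E₄ τ) ∧
      ∀ τ : ℍ, δ (𝕢 1 τ) = ModularForm.discriminant τ := by
  obtain ⟨e₄, he₄, h₄⟩ := exists_ratTaylor_E (k := 4) (by norm_num) (by decide)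
  obtain ⟨e₆, he₆, h₆⟩ := exists_ratTaylor_E (k := 6) (by norm_num) (by decide)
  refine ⟨e₄, he₄, (e₄ ^ 3 - e₆ ^ 2) * fun _ ↦ ((1 / 1728 : ℚ) : ℂ),
    mul_mem (sub_mem (pow_mem he₄ 3) (pow_mem he₆ 2)) (ratCast_mem_ratTaylor _), h₄, fun τ ↦ ?_⟩
  rw [ModularForm.discriminant_eq_E₄_cube_sub_E₆_sq]
  simp only [Pi.mul_apply, Pi.sub_apply, Pi.pow_apply, h₄, h₆]
  push_cast
  ring

lemma sq_mul_weierstrassP_mem_ratTaylor (Λ : PeriodPair) {a b : ℚ} (ha : Λ.g₂ = a)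
    (hb : Λ.g₃ = b) : (fun z ↦ z ^ 2 * Λ.weierstrassP z) ∈ ratTaylor := by
  set u : ℂ → ℂ := fun z ↦ if z = 0 then 1 else z ^ 2 * Λ.weierstrassP z with hu
  have hu1 : ∀ᶠ z in 𝓝[≠] (0 : ℂ), u z = z ^ 2 * Λ.weierstrassP z := by
    filter_upwards [self_mem_nhdsWithin] with z hz
    simp [hu, show z ≠ 0 from hz]
  refine mem_ratTaylor_congr (mem_ratTaylor_of_ode (u := u) ?_ (by simp [hu]) a b ?_) hu1
  · have : u = fun z ↦ z ^ 2 * Λ.weierstrassPExcept 0 z + 1 := by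
      ext z
      have := Λ.ite_eq_one_sub_sq_mul_weierstrassP 0 (zero_mem _) z
      simpa [hu] using this
    rw [this]
    have := Λ.analyticAt_weierstrassPExcept 0
    fun_prop
  · have hΛ : ∀ᶠ z in 𝓝[≠] (0 : ℂ), z ∉ Λ.lattice := by
      filter_upwards [nhdsWithin_le_nhds (Λ.compl_lattice_sdiff_singleton_mem_nhds 0),
        self_mem_nhdsWithin] with z h1 h2 h3
      exact h1 ⟨h3, h2⟩
    filter_upwards [hu1, eventually_eventually_nhdsWithin.2 hu1, hΛ, self_mem_nhdsWithin]
      with z h1 h2 h3 h4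
    rw [IsOpen.nhdsWithin_eq isOpen_compl_singleton h4] at h2
    have hP : HasDerivAt Λ.weierstrassP (Λ.derivWeierstrassP z) z := by
      rw [← Λ.deriv_weierstrassP]
      exact (Λ.analyticOnNhd_weierstrassP z h3).differentiableAt.hasDerivAt
    have h5 : HasDerivAt u (2 * z * Λ.weierstrassP z + z ^ 2 * Λ.derivWeierstrassP z) z := by
      have := ((hasDerivAt_pow 2 z).mul hP).congr_of_eventuallyEq h2
      simpa using this
    rw [h5.deriv, h1, ← ha, ← hb]
    linear_combination z ^ 6 * Λ.derivWeierstrassP_sq z h3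

variable {W : WeierstrassCurve ℚ} {N : ℕ}
  {f : CuspForm (Gamma0 N : Subgroup (GL (Fin 2) ℝ)) 2} {Λ : PeriodPair}

/-- `q dγ/dq` is the cusp function of `f`, whose coefficients are those of the `L`-series and hence
rational. -/
lemma exists_ratTaylor_eichlerIntegral (h : IsOptimalParametrization W N f Λ) :
    ∃ g ∈ ratTaylor, AnalyticAt ℂ g 0 ∧ g 0 = 0 ∧ (∀ᶠ z in 𝓝[≠] (0 : ℂ), g z ≠ 0) ∧
      ∀ τ : ℍ, eichlerIntegral f τ = g (𝕢 1 τ) := by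
  have hΓ := one_mem_strictPeriods_Gamma0 N
  obtain ⟨G, hG0, hG, hGτ, -⟩ := exists_eichlerIntegral_eq f
  have hGd : DifferentiableOn ℂ G (Metric.ball 0 1) := fun q hq ↦
    (hG q hq).differentiableAt.differentiableWithinAt
  have hGa : AnalyticOnNhd ℂ G (Metric.ball 0 1) := hGd.analyticOnNhd Metric.isOpen_ball
  have hG0a : AnalyticAt ℂ G 0 := hGa 0 (by simp)
  refine ⟨G, ?_, hG0a, hG0, ?_, hGτ⟩
  · refine mem_ratTaylor_of_deriv (c := 0) hG0a (by simp [hG0]) ?_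
    refine mem_ratTaylor_congr (f := cuspFunction 1 f) (cuspFunction_mem_ratTaylor
      (ModularFormClass.analyticAt_cuspFunction_zero _ one_pos hΓ)
      fun n ↦ ⟨W.LFunction n, by rw [h.coeff_eq]; simp⟩) ?_
    filter_upwards [nhdsWithin_le_nhds (Metric.ball_mem_nhds (0 : ℂ) one_pos)] with z hz
    rw [(hG z hz).deriv]
    have := sub_smul_dslope (cuspFunction 1 f) 0 z
    rw [CuspFormClass.cuspFunction_apply_zero f one_pos hΓ] at this
    simpa using this.symm
  · rcases hG0a.eventually_eq_zero_or_eventually_ne_zero with h1 | h1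
    · exfalso
      have h2 : EqOn G 0 (Metric.ball 0 1) :=
        hGa.eqOn_zero_of_preconnected_of_eventuallyEq_zero
          (convex_ball (0 : ℂ) 1).isPreconnected (by simp) h1
      obtain ⟨z, hz, hz0⟩ := ((eventually_not_isPole h I).and
        (nhdsWithin_le_nhds (isOpen_upperHalfPlaneSet.mem_nhds I.im_pos))).exists
      lift z to ℍ using hz0
      refine hz ?_
      have hq := Function.Periodic.norm_qParam_lt_one one_pos (ofComplex z).im_pos
      rw [IsPole, hGτ, h2 (by simpa using hq)]
      exact zero_mem _
    · exact h1

/-- `x` and `j` are quotients of functions of `q` with rational Taylor coefficients. -/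
lemma exists_ratTaylor_xFun_kleinJ (h : IsOptimalParametrization W N f Λ) :
    ∃ a ∈ ratTaylor, ∃ b ∈ ratTaylor, ∃ c ∈ ratTaylor, ∃ d ∈ ratTaylor,
      ∀ᶠ q in 𝓝[≠] (0 : ℂ), ∀ τ : ℍ, 𝕢 1 τ = q → ¬ IsPole f Λ τ ∧ b q ≠ 0 ∧ d q ≠ 0 ∧
        xFun W f Λ τ = a q / b q ∧ kleinJ τ = c q / d q := by
  obtain ⟨g, hg, hga, hg0, hgne, hgτ⟩ := exists_ratTaylor_eichlerIntegral h
  obtain ⟨e, he, δ, hδ, heτ, hδτ⟩ := exists_ratTaylor_discriminant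
  have hP := comp_mem_ratTaylor (sq_mul_weierstrassP_mem_ratTaylor Λ (a := W.c₄ / 12)
    (b := W.c₆ / 216) (by rw [h.g₂_eq]; simp) (by rw [h.g₃_eq]; simp)) hg hga hg0 hgne
  refine ⟨_, sub_mem hP (mul_mem (ratCast_mem_ratTaylor (W.b₂ / 12)) (pow_mem hg 2)), _,
    pow_mem hg 2, _, pow_mem he 3, _, hδ, ?_⟩
  have hpole : ∀ᶠ q in 𝓝[≠] (0 : ℂ), g q ∉ (Λ.lattice : Set ℂ) \ {0} := by
    have h0 : ((Λ.lattice : Set ℂ) \ {0})ᶜ ∈ 𝓝 (g 0) := by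
      rw [hg0]
      exact Λ.compl_lattice_sdiff_singleton_mem_nhds 0
    exact nhdsWithin_le_nhds (hga.continuousAt.preimage_mem_nhds h0)
  filter_upwards [hgne, hpole] with q hq hq' τ hτ
  refine ⟨fun hp ↦ hq' ⟨by rwa [IsPole, hgτ, hτ] at hp, hq⟩, by simpa using hq, ?_, ?_, ?_⟩
  · rw [← hτ, hδτ]
    exact ModularForm.discriminant_ne_zero τ
  · rw [xFun, hgτ, hτ, eq_div_iff (by simpa using hq)]
    simp only [Pi.sub_apply, Pi.mul_apply, Pi.pow_apply]
    push_cast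
    ring
  · simp [kleinJ, ← hτ, hδτ, heτ]

lemma natDegree_coeff_le_sup {R : Type*} [CommRing R] (G : R[X][X]) (k : ℕ) :
    (G.coeff k).natDegree ≤ G.support.sup fun k ↦ (G.coeff k).natDegree := by
  by_cases hk : k ∈ G.support
  · exact Finset.le_sup (f := fun k ↦ (G.coeff k).natDegree) hk
  · simp [notMem_support_iff.1 hk]

/-- The bivariate polynomial `∑ c k i xᵏ jⁱ`, where `k ≤ K` and `i ≤ L`. -/
def bivariate {R : Type*} [CommRing R] (K L : ℕ) (c : ℕ → ℕ → R) : R[X][X] :=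
  ∑ s ∈ Finset.range (K + 1) ×ˢ Finset.range (L + 1), monomial s.1 (monomial s.2 (c s.1 s.2))

lemma coeff_bivariate {R : Type*} [CommRing R] (K L : ℕ) (c : ℕ → ℕ → R) (k i : ℕ) :
    ((bivariate K L c).coeff k).coeff i = if k ≤ K ∧ i ≤ L then c k i else 0 := by
  simp only [bivariate, finsetSum_coeff, coeff_monomial, apply_ite (fun p : R[X] ↦ p.coeff i),
    coeff_zero, ← ite_and]
  rw [Finset.sum_congr rfl (g := fun s ↦ if s = (k, i) then c k i else 0) fun s _ ↦ by
    grind]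
  simp [Finset.sum_ite_eq']

lemma natDegree_bivariate_le {R : Type*} [CommRing R] (K L : ℕ) (c : ℕ → ℕ → R) :
    (bivariate K L c).natDegree ≤ K := by
  refine natDegree_sum_le_of_forall_le _ _ fun s hs ↦ (natDegree_monomial_le _).trans ?_
  simp only [Finset.mem_product, Finset.mem_range] at hs
  omega

lemma eq_bivariate {R : Type*} [CommRing R] (G : R[X][X]) {L : ℕ}
    (hL : ∀ k, (G.coeff k).natDegree ≤ L) :
    G = bivariate G.natDegree L fun k i ↦ (G.coeff k).coeff i := by
  ext k i
  rw [coeff_bivariate]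
  split_ifs with h
  · rfl
  · rw [not_and_or, not_le, not_le] at h
    rcases h with h | h
    · rw [coeff_eq_zero_of_natDegree_lt h, coeff_zero]
    · exact coeff_eq_zero_of_natDegree_lt ((hL k).trans_lt h)

lemma map_bivariate {R S : Type*} [CommRing R] [CommRing S] (φ : R →+* S) (K L : ℕ)
    (c : ℕ → ℕ → R) :
    (bivariate K L c).map (mapRingHom φ) = bivariate K L fun k i ↦ φ (c k i) := by
  ext k i
  simp only [coeff_map, coe_mapRingHom, coeff_bivariate]
  split_ifs <;> simp

lemma evalEval_bivariate {F : Type*} [Field F] (K L : ℕ) (c : ℕ → ℕ → F) {x y a b e d : F}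
    (hb : b ≠ 0) (hd : d ≠ 0) (hy : y = a / b) (hx : x = e / d) :
    (b ^ K * d ^ L) * (bivariate K L c).evalEval x y =
      ∑ s ∈ Finset.range (K + 1) ×ˢ Finset.range (L + 1), c s.1 s.2 *
        (a ^ s.1 * b ^ (K - s.1) * e ^ s.2 * d ^ (L - s.2)) := by
  rw [bivariate, evalEval_finsetSum, Finset.mul_sum]
  refine Finset.sum_congr rfl fun s hs ↦ ?_
  simp only [Finset.mem_product, Finset.mem_range, Nat.lt_succ_iff] at hs
  have h1 : b ^ K = b ^ s.1 * b ^ (K - s.1) := by rw [← pow_add]; congr 1; omega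
  have h2 : d ^ L = d ^ s.2 * d ^ (L - s.2) := by rw [← pow_add]; congr 1; omega
  rw [h1, h2, hy, hx]
  simp only [evalEval, eval_monomial, eval_mul, eval_pow, eval_C, div_pow]
  field_simp

/-- A relation over `ℂ` yields a relation over `ℚ` of at most the same degree. -/
lemma exists_isRelation_map_rat [NeZero N] (h : IsOptimalParametrization W N f Λ) {G : ℂ[X][X]}
    (hG : G ≠ 0) (hrel : IsRelation W f Λ G) :
    ∃ F : ℚ[X][X], F ≠ 0 ∧ F.natDegree ≤ G.natDegree ∧
      IsRelation W f Λ (F.map (mapRingHom (algebraMap ℚ ℂ))) := by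
  obtain ⟨a, ha, b, hb, e, he, d, hd, hev⟩ := exists_ratTaylor_xFun_kleinJ h
  obtain ⟨L, hL⟩ : ∃ L, ∀ k, (G.coeff k).natDegree ≤ L := ⟨_, natDegree_coeff_le_sup G⟩
  set K := G.natDegree with hK
  obtain ⟨k, hk⟩ : ∃ k, G.coeff k ≠ 0 := by
    by_contra! h0
    exact hG (Polynomial.ext fun k ↦ by simpa using h0 k)
  obtain ⟨i, hi⟩ : ∃ i, (G.coeff k).coeff i ≠ 0 := by
    by_contra! h0
    exact hk (Polynomial.ext fun k ↦ by simpa using h0 k)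
  -- A `ℚ`-linear form that is nonzero on one chosen coefficient keeps the new polynomial nonzero.
  obtain ⟨l, hl⟩ := Module.exists_dual_forall_apply_ne_zero (K := ℚ)
    (fun _ : Unit ↦ (G.coeff k).coeff i) fun _ ↦ hi
  replace hl : l ((G.coeff k).coeff i) ≠ 0 := hl ()
  refine ⟨bivariate K L fun k i ↦ l ((G.coeff k).coeff i), fun h0 ↦ hl ?_,
    natDegree_bivariate_le _ _ _, ?_⟩
  · have := coeff_bivariate K L (fun k i ↦ l ((G.coeff k).coeff i)) k i
    rw [h0, if_pos ⟨le_natDegree_of_ne_zero hk, (le_natDegree_of_ne_zero hi).trans (hL k)⟩] at this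
    simpa using this.symm
  have h1 : ∀ᶠ q in 𝓝[≠] (0 : ℂ), ∑ s ∈ Finset.range (K + 1) ×ˢ Finset.range (L + 1),
      (G.coeff s.1).coeff s.2 *
        (a ^ s.1 * b ^ (K - s.1) * e ^ s.2 * d ^ (L - s.2)) q = 0 := by
    filter_upwards [hev, self_mem_nhdsWithin,
      nhdsWithin_le_nhds (Metric.ball_mem_nhds (0 : ℂ) one_pos)] with q hq hq0 hq1
    obtain ⟨τ, hτ⟩ : ∃ τ : ℍ, 𝕢 1 τ = q :=
      ⟨⟨Function.Periodic.invQParam 1 q, Function.Periodic.im_invQParam_pos_of_norm_lt_one one_pos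
        (by simpa using hq1) hq0⟩, Function.Periodic.qParam_right_inv one_ne_zero hq0⟩
    obtain ⟨h3, h4, h5, h6, h7⟩ := hq τ hτ
    have := evalEval_bivariate K L (fun k i ↦ (G.coeff k).coeff i) h4 h5 h6 h7
    rw [hK, ← eq_bivariate G hL, hrel τ h3, mul_zero] at this
    simp only [Pi.mul_apply, Pi.pow_apply]
    exact this.symm
  have h2 := sum_apply_mul_eventuallyEq_zero _ _ _ (fun s ↦ mul_mem (mul_mem (mul_mem
    (pow_mem ha _) (pow_mem hb _)) (pow_mem he _)) (pow_mem hd _)) h1 l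
  rw [map_bivariate, isRelation_iff_exists h]
  have h3 : ∀ᶠ q in 𝓝[≠] (0 : ℂ), ∀ τ : ℍ, 𝕢 1 τ = q →
      (bivariate K L fun k i ↦ algebraMap ℚ ℂ (l ((G.coeff k).coeff i))).evalEval (kleinJ τ)
        (xFun W f Λ τ) = 0 := by
    filter_upwards [h2, hev] with q hq hq' τ hτ
    obtain ⟨-, h4, h5, h6, h7⟩ := hq' τ hτ
    have := evalEval_bivariate K L (fun k i ↦ algebraMap ℚ ℂ (l ((G.coeff k).coeff i))) h4 h5 h6 h7
    simp only [Pi.mul_apply, Pi.pow_apply] at hq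
    simp only [eq_ratCast] at this ⊢
    rw [hq] at this
    simpa [h4, h5] using this
  have h4 : Tendsto (fun τ : ℍ ↦ 𝕢 1 τ) atImInfty (𝓝[≠] 0) :=
    tendsto_nhdsWithin_iff.2 ⟨qParam_tendsto_atImInfty one_pos,
      Eventually.of_forall fun τ ↦ Function.Periodic.qParam_ne_zero _⟩
  -- The identity holds near `q = 0`; pulled back near a single `τ` high in `ℍ`, it suffices by the
  -- identity theorem.
  obtain ⟨τ, hτ⟩ := (h4.eventually (eventually_eventually_nhdsWithin.2 h3)).exists
  rw [IsOpen.nhdsWithin_eq isOpen_compl_singleton (Function.Periodic.qParam_ne_zero _)] at hτ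
  refine ⟨τ, meromorphicOrderAt_eq_top_iff.2 ?_⟩
  have h5 := (Function.Periodic.differentiable_qParam (h := 1) τ).continuousAt.eventually hτ
  filter_upwards [nhdsWithin_le_nhds h5,
    nhdsWithin_le_nhds (isOpen_upperHalfPlaneSet.mem_nhds τ.im_pos)] with z hz hz0
  exact hz (ofComplex z) (by rw [ofComplex_apply_of_im_pos hz0])

end RationalExpansions

/-! ### Bivariate polynomials: specialization, swapping, primitivity -/

section Bivariate

open nonZeroDivisors

/-- In `R[X]`, an irreducible polynomial of positive degree and a polynomial it does not divide
generate an ideal containing a nonzero constant. -/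
lemma exists_mul_add_mul_eq_C {R : Type*} [CommRing R] [IsDomain R] [UniqueFactorizationMonoid R]
    {S T : R[X]} (hS : Irreducible S) (hdeg : S.natDegree ≠ 0) (hT : ¬ S ∣ T) :
    ∃ (a b : R[X]) (c : R), c ≠ 0 ∧ a * S + b * T = C c := by
  classical
  let := UniqueFactorizationMonoid.strongNormalizationMonoid (α := R)
  let : NormalizedGCDMonoid R := UniqueFactorizationMonoid.toNormalizedGCDMonoid R
  set K := FractionRing R
  have hprim : S.IsPrimitive := hS.isPrimitive hdeg
  -- By Gauss's lemma `S` stays irreducible over the fraction field; the Bézout identity there is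
  -- then cleared of denominators.
  have hirr := (hprim.irreducible_iff_irreducible_map_fraction_map (K := K)).1 hS
  obtain ⟨a, b, hab⟩ := (hirr.coprime_iff_not_dvd (n := T.map (algebraMap R K))).2 fun h ↦
    hT ((hprim.dvd_iff_fraction_map_dvd_fraction_map K).2 h)
  obtain ⟨c, c0, hc⟩ := IsLocalization.integerNormalization_spec R⁰ a
  obtain ⟨d, d0, hd⟩ := IsLocalization.integerNormalization_spec R⁰ b
  rw [Algebra.smul_def, Polynomial.algebraMap_apply] at hc hd
  refine ⟨C d * IsLocalization.integerNormalization R⁰ a,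
    C c * IsLocalization.integerNormalization R⁰ b, c * d,
    mul_ne_zero (nonZeroDivisors.ne_zero c0) (nonZeroDivisors.ne_zero d0), ?_⟩
  apply map_injective (algebraMap R K) (IsFractionRing.injective _ _)
  simp only [Polynomial.map_add, Polynomial.map_mul, hc, hd, map_C, map_mul]
  linear_combination (C (algebraMap R K c) * C (algebraMap R K d)) * hab

/-- For almost all `α`, the polynomial `S(α, Y)` has as many roots as its degree. -/
lemma exists_forall_card_roots_eq {F : Type*} [Field F] [IsAlgClosed F] [CharZero F] {S : F[X][X]}
    (hS : Irreducible S) : ∃ c : F[X], c ≠ 0 ∧ ∀ α, c.eval α ≠ 0 →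
      ∃ s : Finset F, s.card = S.natDegree ∧ ∀ β ∈ s, S.evalEval α β = 0 := by
  classical
  rcases eq_or_ne S.natDegree 0 with h0 | hdeg
  · exact ⟨1, one_ne_zero, fun α _ ↦ ⟨∅, by simp [h0]⟩⟩
  obtain ⟨a, b, c, hc, habc⟩ := exists_mul_add_mul_eq_C (T := derivative S) hS hdeg fun h ↦ by
    have h1 : derivative S ≠ 0 := fun h ↦ hdeg (derivative_eq_zero.1 h)
    have h2 := natDegree_le_of_dvd h h1
    have := natDegree_derivative_lt hdeg
    omega
  -- Where the leading coefficient does not vanish the degree is preserved; where `c` does not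
  -- vanish the specialization is coprime to its derivative.
  refine ⟨c * S.leadingCoeff, mul_ne_zero hc (leadingCoeff_ne_zero.2 hS.ne_zero), fun α hα ↦ ?_⟩
  rw [eval_mul] at hα
  set p := S.map (evalRingHom α) with hp
  have hpd : p.natDegree = S.natDegree :=
    natDegree_map_of_leadingCoeff_ne_zero _ (by simpa using right_ne_zero_of_mul hα)
  have hp0 : p ≠ 0 := fun h ↦ hdeg (by rw [← hpd, h, natDegree_zero])
  have hsep : p.Separable := by
    have h1 := congrArg (Polynomial.map (evalRingHom α)) habc
    simp only [Polynomial.map_add, Polynomial.map_mul, map_C, ← derivative_map, ← hp] at h1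
    have h2 : (evalRingHom α) c ≠ 0 := left_ne_zero_of_mul hα
    refine ⟨C ((evalRingHom α) c)⁻¹ * a.map (evalRingHom α),
      C ((evalRingHom α) c)⁻¹ * b.map (evalRingHom α), ?_⟩
    rw [mul_assoc, mul_assoc, ← mul_add, h1, ← C_mul, inv_mul_cancel₀ h2, C_1]
  refine ⟨p.roots.toFinset, ?_, fun β hβ ↦ ?_⟩
  · rw [Multiset.toFinset_card_of_nodup (nodup_roots hsep), ← hpd]
    exact (IsAlgClosed.splits p).natDegree_eq_card_roots.symm
  · rw [Multiset.mem_toFinset, mem_roots hp0, IsRoot.def, hp] at hβ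
    rwa [← eval₂_evalRingHom, ← eval_map]

/-- The degree in the inner variable is the outer degree after swapping the variables. -/
lemma natDegree_swap {R : Type*} [CommRing R] (G : R[X][X]) :
    (Bivariate.swap G).natDegree = G.support.sup fun k ↦ (G.coeff k).natDegree := by
  have hL := natDegree_coeff_le_sup G
  have hcoeff : ∀ i k, ((Bivariate.swap G).coeff i).coeff k = (G.coeff k).coeff i := by
    intro i k
    have h1 := eq_bivariate G hL
    have h2 : Bivariate.swap G = bivariate (G.support.sup fun k ↦ (G.coeff k).natDegree)
        G.natDegree fun i k ↦ (G.coeff k).coeff i := by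
      rw [bivariate]
      nth_rewrite 1 [h1]
      rw [bivariate, map_sum]
      simp only [Bivariate.swap_monomial_monomial]
      exact Finset.sum_bij' (fun s _ ↦ s.swap) (fun s _ ↦ s.swap) (by simp; tauto) (by simp; tauto)
        (by simp) (by simp) (by simp)
    rw [h2, coeff_bivariate]
    split_ifs with h
    · rfl
    · rw [not_and_or, not_le, not_le] at h
      rcases h with h | h
      · exact (coeff_eq_zero_of_natDegree_lt ((hL k).trans_lt h)).symm
      · rw [coeff_eq_zero_of_natDegree_lt h, coeff_zero]
  refine le_antisymm (natDegree_le_iff_coeff_eq_zero.2 fun i hi ↦ Polynomial.ext fun k ↦ ?_)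
    (Finset.sup_le fun k _ ↦ natDegree_le_iff_coeff_eq_zero.2 fun i hi ↦ ?_)
  · rw [hcoeff, coeff_zero]
    exact coeff_eq_zero_of_natDegree_lt ((hL k).trans_lt hi)
  · rw [← hcoeff, coeff_eq_zero_of_natDegree_lt hi, coeff_zero]

lemma evalEval_swap {R : Type*} [CommRing R] (G : R[X][X]) (x y : R) :
    (Bivariate.swap G).evalEval x y = G.evalEval y x := by
  rw [← coe_aevalAeval_eq_evalEval, ← coe_aevalAeval_eq_evalEval]
  exact Bivariate.aevalAeval_swap x y G

lemma map_complex_eq (F : ℤ[X][X]) : F.map (mapRingHom (Int.castRingHom ℂ)) =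
    (F.map (mapRingHom (Int.castRingHom ℚ))).map (mapRingHom (algebraMap ℚ ℂ)) := by
  rw [Polynomial.map_map]
  congr 1
  ext <;> simp

/-- Primitivity over `ℤ[X]` is preserved by extending scalars from `ℤ` to `ℂ`. -/
lemma isPrimitive_map_complex {F : ℤ[X][X]} (hF : F.IsPrimitive) :
    (F.map (mapRingHom (Int.castRingHom ℂ))).IsPrimitive := by
  have hQ : (F.map (mapRingHom (Int.castRingHom ℚ))).IsPrimitive := by
    have hinj : Function.Injective (mapRingHom (Int.castRingHom ℚ)) :=
      map_injective _ Int.cast_injective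
    intro r hr
    have hr0 : r ≠ 0 := by
      rintro rfl
      rw [C_0, zero_dvd_iff, Polynomial.map_eq_zero_iff hinj] at hr
      exact hF.ne_zero hr
    obtain ⟨b, hb0, hb⟩ := IsLocalization.integerNormalization_spec ℤ⁰ r
    set n := IsLocalization.integerNormalization ℤ⁰ r with hn
    have hb0' : (b : ℚ) ≠ 0 := by exact_mod_cast nonZeroDivisors.ne_zero hb0
    have hb' : n.map (Int.castRingHom ℚ) = C (b : ℚ) * r := by
      rw [← smul_eq_C_mul, Int.cast_smul_eq_zsmul]; exact hb
    have hdeg : n.primPart.natDegree = r.natDegree := by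
      rw [natDegree_primPart, ← natDegree_map_eq_of_injective (f := Int.castRingHom ℚ)
        Int.cast_injective, hb', natDegree_C_mul hb0']
    have hdvd : n.primPart.map (Int.castRingHom ℚ) ∣ r := by
      have h1 : n.primPart.map (Int.castRingHom ℚ) ∣ C (b : ℚ) * r := by
        rw [← hb']
        exact Polynomial.map_dvd _ n.primPart_dvd
      exact (IsUnit.dvd_mul_left (isUnit_C.2 hb0'.isUnit)).1 h1
    have h2 : IsUnit n.primPart := by
      refine hF _ (C_dvd_iff_dvd_coeff _ _ |>.2 fun k ↦ ?_)
      rw [IsPrimitive.Int.dvd_iff_map_cast_dvd_map_cast _ _ n.isPrimitive_primPart]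
      have h3 := (C_dvd_iff_dvd_coeff _ _).1 hr k
      rw [coeff_map] at h3
      exact hdvd.trans h3
    have h3 := natDegree_eq_zero_of_isUnit h2
    rw [hdeg] at h3
    rw [eq_C_of_natDegree_eq_zero h3] at hr0 ⊢
    exact isUnit_C.2 (isUnit_iff_ne_zero.2 fun h ↦ hr0 (by rw [h, C_0]))
  -- Divisors in `ℂ[X]` need not come from `ℚ[X]`. But `ℚ[X]` is principal, so primitivity there
  -- says that the coefficients generate the unit ideal, and this survives extension of scalars.
  have h1 := (Submodule.IsPrincipal.isPrimitive_iff_contentIdeal_eq_top inferInstance).1 hQ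
  refine isPrimitive_of_contentIdeal_eq_top ?_
  rw [map_complex_eq, contentIdeal_map_eq_map_contentIdeal, h1, Ideal.map_top]

end Bivariate

/-! ### Existence of the modular polynomial and the bound on its degree in `j` -/

section ModularPolynomial

variable {W : WeierstrassCurve ℚ} {N : ℕ}
  {f : CuspForm (Gamma0 N : Subgroup (GL (Fin 2) ℝ)) 2} {Λ : PeriodPair}

lemma natDegree_map_complex (F : ℤ[X][X]) :
    (F.map (mapRingHom (Int.castRingHom ℂ))).natDegree = F.natDegree :=
  natDegree_map_eq_of_injective (map_injective _ Int.cast_injective) F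

lemma jDegree_eq_natDegree_swap (F : ℤ[X][X]) :
    jDegree F = (Bivariate.swap (F.map (mapRingHom (Int.castRingHom ℂ)))).natDegree := by
  have hinj : Function.Injective (mapRingHom (Int.castRingHom ℂ)) :=
    map_injective _ Int.cast_injective
  rw [natDegree_swap, jDegree, support_map_of_injective _ hinj]
  refine Finset.sup_congr rfl fun k _ ↦ ?_
  rw [coeff_map, coe_mapRingHom, natDegree_map_eq_of_injective Int.cast_injective]

/-- Clearing denominators in a bivariate polynomial. -/
lemma exists_map_int_eq_mul (F : ℚ[X][X]) : ∃ (b : ℤ) (F' : ℤ[X][X]), b ≠ 0 ∧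
    F'.map (mapRingHom (Int.castRingHom ℚ)) = C (C (b : ℚ)) * F := by
  have hL := natDegree_coeff_le_sup F
  set L := F.support.sup fun k ↦ (F.coeff k).natDegree
  obtain ⟨b, hb⟩ := IsLocalization.exist_integer_multiples_of_finset (nonZeroDivisors ℤ)
    ((Finset.range (F.natDegree + 1) ×ˢ Finset.range (L + 1)).image
      fun s ↦ (F.coeff s.1).coeff s.2)
  have hb' : ∀ k i, ∃ c : ℤ, k ≤ F.natDegree → i ≤ L →
      (c : ℚ) = (b : ℤ) * (F.coeff k).coeff i := by
    intro k i
    by_cases h : k ≤ F.natDegree ∧ i ≤ L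
    · obtain ⟨c, hc⟩ := hb ((F.coeff k).coeff i) (Finset.mem_image.2 ⟨(k, i), by
        simp only [Finset.mem_product, Finset.mem_range]; omega, rfl⟩)
      exact ⟨c, fun _ _ ↦ by simpa using hc⟩
    · exact ⟨0, fun h1 h2 ↦ absurd ⟨h1, h2⟩ h⟩
  choose c hc using hb'
  refine ⟨b, bivariate F.natDegree L c, nonZeroDivisors.ne_zero b.2, ?_⟩
  rw [map_bivariate]
  ext k i
  rw [coeff_bivariate, coeff_C_mul, coeff_C_mul]
  split_ifs with h
  · simpa using hc k i h.1 h.2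
  · rw [not_and_or, not_le, not_le] at h
    rcases h with h | h
    · rw [coeff_eq_zero_of_natDegree_lt h, coeff_zero, mul_zero]
    · rw [coeff_eq_zero_of_natDegree_lt ((hL k).trans_lt h), mul_zero]

/-- `x` satisfies an equation over `ℂ[j]` whose specializations have all their roots among the
values of `x`. -/
lemma exists_relation_natDegree_le_index [NeZero N] (h : IsOptimalParametrization W N f Λ) :
    ∃ (P : ℂ[X][X]) (D : ℂ[X]), D ≠ 0 ∧ P.natDegree ≤ (Gamma0 N).index ∧ P ≠ 0 ∧
      IsRelation W f Λ P ∧ ∀ τ α, D.eval (kleinJ τ) ≠ 0 → P.evalEval (kleinJ τ) α = 0 →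
        ∃ M : SL(2, ℤ), xFun W f Λ (M • τ) = α := by
  obtain ⟨P, D, hD, hdeg, hP, h1, h2⟩ := exists_evalEval_kleinJ_eq_prod (xFun W f Λ)
    (fun A hA τ ↦ xFun_smul h hA τ) (xFun_smul_mem_meroRing W f Λ)
  exact ⟨P, D, hD, hdeg, hP, fun τ _ ↦ h1 τ, h2⟩

lemma exists_isModularPolynomial [NeZero N] (h : IsOptimalParametrization W N f Λ) :
    ∃ F : ℤ[X][X], IsModularPolynomial W f Λ F := by
  obtain ⟨P, -, -, -, hP, hPrel, -⟩ := exists_relation_natDegree_le_index h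
  obtain ⟨G, ⟨hG, hGrel⟩, hmin⟩ := WellFounded.has_min
    (measure (natDegree : ℂ[X][X] → ℕ)).wf {G | G ≠ 0 ∧ IsRelation W f Λ G} ⟨P, hP, hPrel⟩
  obtain ⟨F₀, hF₀, hdeg, hF₀rel⟩ := exists_isRelation_map_rat h hG hGrel
  obtain ⟨b, F₁, hb, hF₁⟩ := exists_map_int_eq_mul F₀
  have hbQ : (b : ℚ) ≠ 0 := by exact_mod_cast hb
  have hinj : Function.Injective (mapRingHom (Int.castRingHom ℚ)) :=
    map_injective _ Int.cast_injective
  have hF₁0 : F₁ ≠ 0 := by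
    rintro rfl
    rw [Polynomial.map_zero, eq_comm, mul_eq_zero] at hF₁
    rcases hF₁ with h1 | h1
    · exact hbQ (by simpa using h1)
    · exact hF₀ h1
  have hF₁deg : F₁.natDegree = F₀.natDegree := by
    rw [← natDegree_map_eq_of_injective hinj F₁, hF₁, natDegree_C_mul (by simpa using hb)]
  have hF₁rel : IsRelation W f Λ (F₁.map (mapRingHom (Int.castRingHom ℂ))) := by
    rw [map_complex_eq, hF₁, Polynomial.map_mul]
    exact hF₀rel.mul_left _
  let := UniqueFactorizationMonoid.strongNormalizationMonoid (α := ℤ[X])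
  let : NormalizedGCDMonoid ℤ[X] := UniqueFactorizationMonoid.toNormalizedGCDMonoid ℤ[X]
  refine ⟨F₁.primPart, F₁.primPart_ne_zero, ?_, fun G' hG' hG'rel ↦ ?_, F₁.isPrimitive_primPart⟩
  -- The relation factors as content times primitive part; the content is a nonzero polynomial in
  -- `j`, so it is not a relation.
  · rw [F₁.eq_C_content_mul_primPart, Polynomial.map_mul, map_C] at hF₁rel
    refine (hF₁rel.of_mul h).resolve_left fun h1 ↦ hF₁0 (content_eq_zero_iff.1 ?_)
    have h2 := h1.eq_zero_of_C h
    exact (map_eq_zero_iff _ (map_injective (Int.castRingHom ℂ) Int.cast_injective)).1 h2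
  · rw [natDegree_primPart, hF₁deg]
    exact hdeg.trans (not_lt.1 (hmin G' ⟨hG', hG'rel⟩))

namespace IsModularPolynomial

/-- In a factorization one factor is again a relation. Minimality makes the other constant in `x`,
and primitivity makes that constant a unit. -/
lemma irreducible_map [NeZero N] (h : IsOptimalParametrization W N f Λ) {F : ℤ[X][X]}
    (hF : IsModularPolynomial W f Λ F) : Irreducible (F.map (mapRingHom (Int.castRingHom ℂ))) := by
  have hprim := isPrimitive_map_complex hF.primitive
  have key : ∀ A B : ℂ[X][X], F.map (mapRingHom (Int.castRingHom ℂ)) = A * B →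
      IsRelation W f Λ A → IsUnit B := by
    intro A B hAB hA
    have h0 : A * B ≠ 0 := hAB ▸ hprim.ne_zero
    have h1 := hF.minimal A (left_ne_zero_of_mul h0) hA
    rw [← natDegree_map_complex, hAB, natDegree_mul (left_ne_zero_of_mul h0)
      (right_ne_zero_of_mul h0)] at h1
    have h2 : B = C (B.coeff 0) := eq_C_of_natDegree_eq_zero (by omega)
    rw [h2]
    refine isUnit_C.2 (hprim _ ?_)
    rw [← h2, hAB]
    exact dvd_mul_left _ _
  refine ⟨fun hu ↦ ?_, fun A B hAB ↦ ?_⟩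
  · obtain ⟨c, hc, hcF⟩ := Polynomial.isUnit_iff.1 hu
    have h1 := hF.relation
    rw [← hcF] at h1
    exact hc.ne_zero (h1.eq_zero_of_C h)
  · have h1 := hF.relation
    rw [hAB] at h1
    rcases h1.of_mul h with h2 | h2
    · exact .inr (key A B hAB h2)
    · exact .inl (key B A (hAB.trans (mul_comm _ _)) h2)

lemma natDegree_ne_zero (h : IsOptimalParametrization W N f Λ) {F : ℤ[X][X]}
    (hF : IsModularPolynomial W f Λ F) :
    (F.map (mapRingHom (Int.castRingHom ℂ))).natDegree ≠ 0 := fun h0 ↦ by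
  have h1 := hF.relation
  rw [eq_C_of_natDegree_eq_zero h0] at h1
  have h2 := eq_C_of_natDegree_eq_zero h0
  rw [h1.eq_zero_of_C h, C_0] at h2
  exact (isPrimitive_map_complex hF.primitive).ne_zero h2

/-- Otherwise a combination of the two relations would be a nonzero polynomial in `j` alone that
vanishes. -/
lemma map_dvd [NeZero N] (h : IsOptimalParametrization W N f Λ) {F : ℤ[X][X]}
    (hF : IsModularPolynomial W f Λ F) {G : ℂ[X][X]} (hG : IsRelation W f Λ G) :
    F.map (mapRingHom (Int.castRingHom ℂ)) ∣ G := by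
  by_contra hdvd
  obtain ⟨a, b, c, hc, habc⟩ := exists_mul_add_mul_eq_C (hF.irreducible_map h)
    (hF.natDegree_ne_zero h) hdvd
  refine hc (IsRelation.eq_zero_of_C h (W := W) (f := f) (Λ := Λ) ?_)
  rw [← habc]
  intro τ hτ
  rw [evalEval_add, hF.relation.mul_left a τ hτ, hG.mul_left b τ hτ, add_zero]

/-- The specialization of a modular polynomial at a value of `j` is not zero. -/
lemma map_map_evalRingHom_ne_zero {F : ℤ[X][X]}
    (hF : IsModularPolynomial W f Λ F) (β : ℂ) :
    (F.map (mapRingHom (Int.castRingHom ℂ))).map (evalRingHom β) ≠ 0 := by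
  intro h0
  have h1 : C (X - C β) ∣ F.map (mapRingHom (Int.castRingHom ℂ)) := by
    refine (C_dvd_iff_dvd_coeff _ _).2 fun k ↦ dvd_iff_isRoot.2 ?_
    have := congrArg (coeff · k) h0
    simpa using this
  exact not_isUnit_X_sub_C β (isPrimitive_map_complex hF.primitive _ h1)

end IsModularPolynomial

/-- The affine point of the curve parametrized by `τ`. -/
lemma equation_xFun_yFun (h : IsOptimalParametrization W N f Λ) {τ : ℍ} (hτ : ¬ IsPole f Λ τ) :
    (W.baseChange ℂ).toAffine.Equation (xFun W f Λ τ) (yFun W f Λ τ) := by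
  have h1 := Λ.derivWeierstrassP_sq _ hτ
  rw [h.g₂_eq, h.g₃_eq, WeierstrassCurve.c₄, WeierstrassCurve.c₆, WeierstrassCurve.b₂,
    WeierstrassCurve.b₄, WeierstrassCurve.b₆] at h1
  rw [WeierstrassCurve.Affine.equation_iff]
  simp only [WeierstrassCurve.map_a₁, WeierstrassCurve.map_a₂, WeierstrassCurve.map_a₃,
    WeierstrassCurve.map_a₄, WeierstrassCurve.map_a₆, eq_ratCast,
    WeierstrassCurve.baseChange, xFun, yFun, WeierstrassCurve.b₂]
  push_cast at h1 ⊢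
  linear_combination h1 / 4

/-- At most `2 d` points of `Y₀(N)` have a given first coordinate, outside a finite set. -/
lemma encard_le_two_mul (h : IsOptimalParametrization W N f Λ) {d : ℕ} {α : ℂ}
    (hα : ∀ y, (W.baseChange ℂ).toAffine.Equation α y → (fibre W f Λ N α y).encard = d) :
    {P : MulAction.orbitRel.Quotient (Gamma0 N) ℍ | ∃ τ : ℍ, Quotient.mk _ τ = P ∧
      ¬ IsPole f Λ τ ∧ xFun W f Λ τ = α}.encard ≤ 2 * d := by
  set S := {P : MulAction.orbitRel.Quotient (Gamma0 N) ℍ | ∃ τ : ℍ, Quotient.mk _ τ = P ∧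
      ¬ IsPole f Λ τ ∧ xFun W f Λ τ = α} with hS
  rcases S.eq_empty_or_nonempty with h0 | ⟨P, τ₀, -, hτ₀, hxτ₀⟩
  · simp [h0]
  have heq := equation_xFun_yFun h hτ₀
  rw [hxτ₀] at heq
  set y₁ := yFun W f Λ τ₀
  set y₂ := (W.baseChange ℂ).toAffine.negY α y₁ with hy₂
  have heq₂ : (W.baseChange ℂ).toAffine.Equation α y₂ :=
    (WeierstrassCurve.Affine.equation_neg _ _).2 heq
  -- Only two ordinates lie over `α`, exchanged by negation; if they coincide the count is merely
  -- generous.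
  have hsub : S ⊆ fibre W f Λ N α y₁ ∪ fibre W f Λ N α y₂ := by
    rintro P ⟨τ, hτP, hτ, hxτ⟩
    have h1 := equation_xFun_yFun h hτ
    rw [hxτ] at h1
    have h2 : yFun W f Λ τ = y₁ ∨ yFun W f Λ τ = y₂ :=
      WeierstrassCurve.Affine.Y_eq_of_X_eq h1 heq rfl
    exact h2.imp (fun h3 ↦ ⟨τ, hτP, hτ, hxτ, h3⟩) (fun h3 ↦ ⟨τ, hτP, hτ, hxτ, h3⟩)
  calc S.encard ≤ _ := encard_le_encard hsub
    _ ≤ _ := encard_union_le _ _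
    _ = 2 * d := by rw [hα _ heq, hα _ heq₂, two_mul]

lemma IsModularPolynomial.jDegree_le [NeZero N] (h : IsOptimalParametrization W N f Λ) {d : ℕ}
    (hd : HasDegree W f Λ N d) {F : ℤ[X][X]} (hF : IsModularPolynomial W f Λ F) :
    jDegree F ≤ 2 * d := by
  classical
  obtain ⟨P, D, hD, -, -, hPrel, hPD⟩ := exists_relation_natDegree_le_index h
  obtain ⟨H, rfl⟩ := hF.map_dvd h hPrel
  set G := F.map (mapRingHom (Int.castRingHom ℂ)) with hG
  obtain ⟨c, hc, hroots⟩ := exists_forall_card_roots_eq (S := Bivariate.swap G)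
    ((MulEquiv.irreducible_iff (Bivariate.swap (R := ℂ))).2 (hF.irreducible_map h))
  -- Excluded are the `α` for which `F(α, Y)` may lack its full number of distinct roots, the
  -- default value of `x` at poles, the abscissas of exceptional fibres, and the `α` with `F(α, β) =
  -- 0` for a root `β` of `D`. The last are finitely many because no `F(X, β)` is zero.
  have hbad : ({α | c.eval α = 0} ∪ {-(W.b₂ : ℂ) / 12} ∪ (Prod.fst '' {P : ℂ × ℂ |
      (W.baseChange ℂ).toAffine.Equation P.1 P.2 ∧
        (fibre W f Λ N P.1 P.2).encard ≠ (d : ℕ∞)}) ∪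
      ⋃ β ∈ D.roots.toFinset, {α | G.evalEval β α = 0}).Finite := by
    refine (((finite_setOfPred_isRoot hc).union (finite_singleton _)).union (hd.image _)).union
      (D.roots.toFinset.finite_toSet.biUnion fun β _ ↦ ?_)
    have := finite_setOfPred_isRoot (hF.map_map_evalRingHom_ne_zero β)
    simpa only [IsRoot.def, eval_map, eval₂_evalRingHom] using this
  obtain ⟨α, hα⟩ := hbad.infinite_compl.nonempty
  simp only [mem_compl_iff, mem_union, not_or, mem_ofPred_eq, mem_singleton_iff, mem_iUnion,
    not_exists, Multiset.mem_toFinset] at hα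
  obtain ⟨⟨⟨hα₁, hα₂⟩, hα₃⟩, hα₄⟩ := hα
  obtain ⟨s, hs, hsroots⟩ := hroots α hα₁
  have hpt : ∀ β ∈ s, ∃ τ : ℍ, ¬ IsPole f Λ τ ∧ xFun W f Λ τ = α ∧ kleinJ τ = β := by
    intro β hβ
    have h1 := hsroots β hβ
    rw [evalEval_swap] at h1
    have h2 : D.eval β ≠ 0 := fun h2 ↦ hα₄ β ((mem_roots hD).2 h2) h1
    obtain ⟨τ, rfl⟩ := kleinJ_surjective β
    obtain ⟨M, hM⟩ := hPD τ α h2 (by rw [evalEval_mul, h1, zero_mul])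
    refine ⟨M • τ, fun hp ↦ hα₂ ?_, hM, kleinJ_smul M τ⟩
    rw [← hM, xFun_of_isPole hp]
  choose! t ht using hpt
  have hcard := encard_le_two_mul (α := α) h (d := d) fun y hy ↦ by
    by_contra hne
    exact hα₃ ⟨(α, y), ⟨hy, hne⟩, rfl⟩
  -- Since `j` is constant on orbits, distinct roots `β` give distinct points of `Y₀(N)`.
  have hinj : InjOn (fun β ↦ (Quotient.mk _ (t β) : MulAction.orbitRel.Quotient (Gamma0 N) ℍ))
      (s : Set ℂ) := by
    intro β hβ β' hβ' heq
    obtain ⟨A, hA⟩ := Quotient.exact heq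
    have h1 : (A : SL(2, ℤ)) • t β' = t β := hA
    rw [← (ht β hβ).2.2, ← (ht β' hβ').2.2, ← h1, kleinJ_smul]
  have hle := (hinj.encard_image.symm.le.trans (encard_le_encard (by
    rintro _ ⟨β, hβ, rfl⟩
    exact ⟨t β, rfl, (ht β hβ).1, (ht β hβ).2.1⟩))).trans hcard
  rw [encard_coe_eq_coe_finsetCard, hs, ← jDegree_eq_natDegree_swap] at hle
  exact_mod_cast hle

end ModularPolynomial

end ModularParam

end

theorem proposition2p1 (W : WeierstrassCurve ℚ) [W.IsElliptic] (N : ℕ) [NeZero N]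
    (f : CuspForm (Gamma0 N : Subgroup (GL (Fin 2) ℝ)) 2) (Λ : PeriodPair)
    (h : ModularParam.IsOptimalParametrization W N f Λ)
    (d : ℕ) (hd : ModularParam.HasDegree W f Λ N d) :
    (∃ F : ℤ[X][X], ModularParam.IsModularPolynomial W f Λ F) ∧
      ∀ F : ℤ[X][X], ModularParam.IsModularPolynomial W f Λ F →
        ModularParam.xDegree F ≤ (Gamma0 N).index ∧ ModularParam.jDegree F ≤ 2 * d := by
  refine ⟨ModularParam.exists_isModularPolynomial h, fun F hF ↦ ⟨?_, hF.jDegree_le h hd⟩⟩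
  obtain ⟨P, -, -, hdeg, hP, hrel, -⟩ := ModularParam.exists_relation_natDegree_le_index h
  exact (hF.minimal P hP hrel).trans hdeg
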